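/- **Definitions.** For a metric space $(X,d)$ and $f:X\to\mathbb R$ put $|\nabla f|(x)=\limsup_{y\to x,\,y\neq x}|f(y)-f(x)|/d(x,y)$. A Borel probability measure $\mu$ on $X$ satisfies $LSI(\alpha)$, $\alpha>0$, if $$\int_X f^2\log\Bigl(f^2\Big/\int_X f^2\,d\mu\Bigr)d\mu\le\frac2\alpha\int_X|\nabla f|^2\,d\mu$$ for every $f\in L^2(\mu)$ for which $|\nabla f|$ is finite at every point of $X$ and belongs to $L^2(\mu)$ (in particular the left-hand side is then finite). For metric probability spaces $\hat X=(X,d_X,\mu)$ and $\hat Y=(Y,d_Y,\nu)$, the $L^2$ transportation distance is $$D_{L^2}(\hat X,\hat Y)=\inf_{\delta,\pi}\Bigl(\iint_{X\times Y}\delta(x,y)^2\,\pi(dx\,dy)\Bigr)^{1/2},$$ where $\delta$ runs over the pseudo metrics $\delta$ with values in $[0,\infty]$ on the disjoint union $X\sqcup Y$ that restrict to $d_X$ on $X$ and to $d_Y$ on $Y$, and $\pi$ over the probability measures on $X\times Y$ with marginals $\mu$ and $\nu$. **Lemma 2.1.** Let $\nu$ be a Radon probability measure on $\ell^2=\ell^2(\mathbb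 N;\mathbb R)$, and for $n\ge1$ let $\nu_n$ be the marginal of $\nu$ for the first $n$ coordinates. Suppose that there is $\alpha>0$ such that $X^n=(\mathbb R^n,\|\cdot\|_{\ell^2},\nu_n)$ satisfies $LSI(\alpha)$ for all $n\ge1$. Then $X^\infty=(\ell^2,\|\cdot\|_{\ell^2},\nu)$ satisfies $LSI(\alpha)$, and $D_{L^2}(X^n,X^\infty)\to0$ as $n\to\infty$. No further assumption on $\nu$ is made; in particular, the lemma covers every $\nu$ that is formally of the shape $e^{-V(x)}\prod_{j}dx_j$ with $V$ continuously differentiable and $\int\|\nabla V\|_{\ell^2}^2\,d\nu<\infty$. -/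

import Mathlib

open MeasureTheory Filter Topology
open scoped ENNReal

noncomputable section

/-- The norm of the gradient `|∇f|(x) = limsup_{y → x, y ≠ x} |f y - f x| / d(y, x)`,
as an extended nonnegative number. -/
def gradNorm {X : Type*} [MetricSpace X] (f : X → ℝ) (x : X) : ℝ≥0∞ :=
  limsup (fun y => ENNReal.ofReal (|f y - f x| / dist y x)) (𝓝[≠] x)

/-- The logarithmic Sobolev inequality `LSI(α)` for `(X, d, μ)`: it is required of every
`f ∈ L²(μ)` whose gradient norm is a (finite) real-valued function that lies in `L²(μ)`.
The negative part of `f² log (f² / ∫ f²)` is always integrable, so that its integrability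
says that the entropy is not `+∞`. -/
def LSI {X : Type*} [MetricSpace X] [MeasurableSpace X] (μ : Measure X) (α : ℝ) : Prop :=
  ∀ f : X → ℝ, MemLp f 2 μ → (∀ x, gradNorm f x ≠ ∞) →
    MemLp (fun x => (gradNorm f x).toReal) 2 μ →
    Integrable (fun x => f x ^ 2 * Real.log (f x ^ 2 / ∫ z, f z ^ 2 ∂μ)) μ ∧
      ∫ x, f x ^ 2 * Real.log (f x ^ 2 / ∫ z, f z ^ 2 ∂μ) ∂μ ≤
        2 / α * ∫ x, (gradNorm f x).toReal ^ 2 ∂μ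

/-- `δ` is a coupling of the metric spaces `X` and `Y`: a pseudo metric with values in `[0, ∞]`
on the disjoint union of `X` and `Y` that restricts to the given metrics. -/
structure IsMetricCoupling {X Y : Type*} [MetricSpace X] [MetricSpace Y]
    (δ : X ⊕ Y → X ⊕ Y → ℝ≥0∞) : Prop where
  self : ∀ z, δ z z = 0
  symm : ∀ z w, δ z w = δ w z
  triangle : ∀ z w v, δ z v ≤ δ z w + δ w v
  left : ∀ x x' : X, δ (Sum.inl x) (Sum.inl x') = edist x x'
  right : ∀ y y' : Y, δ (Sum.inr y) (Sum.inr y') = edist y y'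

/-- `π` is a transportation plan between `μ` and `ν`: its marginals are `μ` and `ν`. -/
def IsTransportPlan {X Y : Type*} [MeasurableSpace X] [MeasurableSpace Y]
    (μ : Measure X) (ν : Measure Y) (π : Measure (X × Y)) : Prop :=
  π.map Prod.fst = μ ∧ π.map Prod.snd = ν

/-- The `L²` transportation distance between `(X, d, μ)` and `(Y, d, ν)`. -/
def DL2 {X Y : Type*} [MetricSpace X] [MeasurableSpace X] [MetricSpace Y] [MeasurableSpace Y]
    (μ : Measure X) (ν : Measure Y) : ℝ≥0∞ :=
  ⨅ (δ : X ⊕ Y → X ⊕ Y → ℝ≥0∞) (_ : IsMetricCoupling δ)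
    (π : Measure (X × Y)) (_ : IsTransportPlan μ ν π),
    (∫⁻ p, δ (Sum.inl p.1) (Sum.inr p.2) ^ 2 ∂π) ^ (1 / 2 : ℝ)

/-- The real Hilbert space `ℓ²(ℕ; ℝ)`. -/
abbrev ellTwo : Type := lp (fun _ : ℕ => ℝ) 2

/-- The first `n` coordinates, as a point of Euclidean space. -/
def firstCoords (n : ℕ) (x : ellTwo) : EuclideanSpace ℝ (Fin n) :=
  WithLp.toLp 2 (fun i : Fin n => x i)

/-- The marginal of `ν` for the first `n` coordinates. -/
def marginal [MeasurableSpace ellTwo] (ν : Measure ellTwo) (n : ℕ) :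
    Measure (EuclideanSpace ℝ (Fin n)) :=
  ν.map (firstCoords n)

end

open scoped NNReal

/-!
The main point is that `LSI(α)` passes from the marginals to `ν` although `|∇f|` is only a
measurable function. Truncation and Fatou's lemma for the entropy reduce the claim to bounded `f`.
By the Vitali–Carathéodory theorem and the tightness of `ν` there is a lower semicontinuous
`h > |∇f|` with compact sublevel sets and almost the same `L²` norm; it is the increasing limit of
bounded Lipschitz functions `hₖ`. Let `uₖ` be the largest function that is bounded by `f` from above
and by a constant from below and has slope at most `hₖ`. Since `hₖ` is continuous and bounded, the
inequality for the functions `uₖ ∘ ιₙ` on the marginals converges, as `n → ∞`, to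
`Ent(uₖ²) ≤ (2/α) ∫ hₖ²`. Finally `uₖ → f`: otherwise Ekeland's variational principle, applied to
`sup uₖ - f`, produces a point at which `f` would have slope larger than `h`; the compactness of the
sublevel sets of `h` is what allows one to let `k → ∞` there.

For the convergence in `D_{L²}`, the inequality for truncations of `|x|` gives `ν` a finite second
moment, and the image of `ν` under `x ↦ (pₙ x, x)` is a transport plan whose cost tends to zero by
the Banach–Steinhaus theorem and dominated convergence.
-/

section GradNorm

variable {X Y : Type*} [MetricSpace X] [MetricSpace Y] {f g : X → ℝ} {x : X}

/-- The absolute difference quotient of `f` between `x` and `y`; it vanishes for `y = x`. -/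
noncomputable def absSlope (f : X → ℝ) (x y : X) : ℝ≥0∞ :=
  ENNReal.ofReal (|f y - f x| / dist y x)

@[simp]
theorem absSlope_self (f : X → ℝ) (x : X) : absSlope f x x = 0 := by simp [absSlope]

theorem absSlope_le_coe_iff {y : X} {L : ℝ≥0} :
    absSlope f x y ≤ L ↔ |f y - f x| ≤ L * dist y x := by
  rcases eq_or_ne y x with rfl | hyx
  · simp
  · rw [absSlope, ← ENNReal.ofReal_coe_nnreal, ENNReal.ofReal_le_ofReal_iff L.coe_nonneg,
      div_le_iff₀ (dist_pos.2 hyx)]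

theorem gradNorm_eq_limsup_nhds (f : X → ℝ) (x : X) :
    gradNorm f x = limsup (absSlope f x) (𝓝 x) := by
  have limsup_pure : limsup (absSlope f x) (pure x) = 0 := by simp [limsup_eq]
  rw [← nhdsNE_sup_pure, limsup_sup_filter, limsup_pure, ← bot_eq_zero, sup_bot_eq]
  rfl

theorem gradNorm_le_coe_iff {L : ℝ≥0} :
    gradNorm f x ≤ L ↔ ∀ L' > L, ∀ᶠ y in 𝓝 x, |f y - f x| ≤ L' * dist y x := by
  simp only [gradNorm_eq_limsup_nhds, ← absSlope_le_coe_iff]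
  constructor
  · intro h L' hL'
    exact (eventually_lt_of_limsup_lt (h.trans_lt (ENNReal.coe_lt_coe.2 hL'))).mono
      fun _ => le_of_lt
  · intro h
    refine ENNReal.le_of_forall_pos_le_add fun ε hε _ => limsup_le_of_le (by isBoundedDefault) ?_
    exact_mod_cast h (L + ε) (lt_add_of_pos_right L hε)

theorem gradNorm_le_of_forall_abs_sub_le {L : ℝ≥0} (h : ∀ y, |f y - f x| ≤ L * dist y x) :
    gradNorm f x ≤ L :=
  gradNorm_eq_limsup_nhds f x ▸ limsup_le_of_le (by isBoundedDefault)
    (Eventually.of_forall fun y => absSlope_le_coe_iff.2 (h y))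

theorem gradNorm_le_of_lipschitzWith {K : ℝ≥0} (hf : LipschitzWith K f) (x : X) :
    gradNorm f x ≤ K :=
  gradNorm_le_of_forall_abs_sub_le fun y => hf.dist_le_mul y x

theorem gradNorm_congr (h : f =ᶠ[𝓝 x] g) : gradNorm f x = gradNorm g x :=
  limsup_congr <| (h.filter_mono nhdsWithin_le_nhds).mono fun y hy => by rw [hy, h.eq_of_nhds]

theorem gradNorm_comp_le {K : ℝ≥0} {φ : Y → X} (hφ : LipschitzWith K φ) (f : X → ℝ) (y : Y) :
    gradNorm (f ∘ φ) y ≤ K * gradNorm f (φ y) := by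
  have absSlope_comp_le (z : Y) : absSlope (f ∘ φ) y z ≤ K * absSlope f (φ y) (φ z) := by
    lift absSlope f (φ y) (φ z) to ℝ≥0 using ENNReal.ofReal_ne_top with M hM
    rw [← ENNReal.coe_mul, absSlope_le_coe_iff]
    calc |f (φ z) - f (φ y)| ≤ M * dist (φ z) (φ y) := absSlope_le_coe_iff.1 hM.ge
      _ ≤ M * (K * dist z y) := by gcongr; exact hφ.dist_le_mul z y
      _ = (K * M : ℝ≥0) * dist z y := by push_cast; ring
  calc gradNorm (f ∘ φ) y
      ≤ limsup (fun z => K * absSlope f (φ y) (φ z)) (𝓝 y) := by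
        rw [gradNorm_eq_limsup_nhds]
        exact limsup_le_limsup (Eventually.of_forall absSlope_comp_le)
    _ = K * limsup (absSlope f (φ y)) (map φ (𝓝 y)) :=
        ENNReal.limsup_const_mul_of_ne_top ENNReal.coe_ne_top
    _ ≤ K * gradNorm f (φ y) := by
        rw [gradNorm_eq_limsup_nhds]
        gcongr
        exact limsup_le_limsup_of_le hφ.continuous.continuousAt.tendsto

theorem gradNorm_comp_left_le {K : ℝ≥0} {ψ : ℝ → ℝ} (hψ : LipschitzWith K ψ) (f : X → ℝ) (x : X) :
    gradNorm (ψ ∘ f) x ≤ K * gradNorm f x := by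
  simp only [gradNorm_eq_limsup_nhds]
  rw [← ENNReal.limsup_const_mul_of_ne_top ENNReal.coe_ne_top]
  refine limsup_le_limsup (Eventually.of_forall fun y => ?_)
  simp only [absSlope]
  rw [← ENNReal.ofReal_coe_nnreal, ← ENNReal.ofReal_mul K.coe_nonneg, mul_div_assoc']
  gcongr
  exact hψ.dist_le_mul (f y) (f x)

theorem gradNorm_max_le (hf : Continuous f) (hg : Continuous g) {L : ℝ≥0} (hfL : gradNorm f x ≤ L)
    (hgL : f x ≤ g x → gradNorm g x ≤ L) : gradNorm (fun y => max (f y) (g y)) x ≤ L := by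
  rcases lt_or_ge (g x) (f x) with hlt | hle
  · have heq : (fun y => max (f y) (g y)) =ᶠ[𝓝 x] f :=
      (hg.continuousAt.eventually_lt hf.continuousAt hlt).mono fun y hy => max_eq_left hy.le
    rwa [gradNorm_congr heq]
  · refine gradNorm_le_coe_iff.2 fun L' hL' => ?_
    filter_upwards [gradNorm_le_coe_iff.1 hfL L' hL', gradNorm_le_coe_iff.1 (hgL hle) L' hL']
      with y hfy hgy
    exact (abs_max_sub_max_le_max _ _ _ _).trans (max_le hfy hgy)

theorem continuousAt_of_gradNorm_ne_top (h : gradNorm f x ≠ ∞) : ContinuousAt f x := by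
  lift gradNorm f x to ℝ≥0 using h with L hL
  have hbound := gradNorm_le_coe_iff.1 hL.ge (L + 1) (lt_add_one L)
  have hlim : Tendsto (fun y => ((L + 1 : ℝ≥0) : ℝ) * dist y x) (𝓝 x) (𝓝 0) :=
    Continuous.tendsto' (by fun_prop) _ _ (by simp)
  exact tendsto_iff_dist_tendsto_zero.2
    (squeeze_zero' (Eventually.of_forall fun _ => dist_nonneg) hbound hlim)

theorem continuous_of_gradNorm_ne_top (h : ∀ x, gradNorm f x ≠ ∞) : Continuous f :=
  continuous_iff_continuousAt.2 fun x => continuousAt_of_gradNorm_ne_top (h x)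

theorem lowerSemicontinuous_iSup_ball_absSlope (hf : Continuous f) (r : ℝ) :
    LowerSemicontinuous fun x => ⨆ y ∈ Metric.ball x r, absSlope f x y := by
  intro x c hc
  simp only [lt_iSup_iff] at hc
  obtain ⟨y, hy, hcy⟩ := hc
  have hyx : y ≠ x := by
    rintro rfl
    simp at hcy
  have hcont : ContinuousAt (fun z => absSlope f z y) x :=
    ENNReal.continuous_ofReal.continuousAt.comp
      (ContinuousAt.div (by fun_prop) (by fun_prop) (dist_ne_zero.2 hyx))
  have hball : ∀ᶠ z in 𝓝 x, y ∈ Metric.ball z r :=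
    (continuous_const.dist continuous_id).continuousAt.eventually_lt_const hy
  filter_upwards [hball, hcont.eventually_const_lt hcy] with z hyz hcz
  exact hcz.trans_le (le_iSup₂ (f := fun w (_ : w ∈ Metric.ball z r) => absSlope f z w) y hyz)

theorem measurable_gradNorm [MeasurableSpace X] [BorelSpace X] (hf : Continuous f) :
    Measurable (gradNorm f) := by
  have gradNorm_eq_iInf (x : X) : gradNorm f x =
      ⨅ n : ℕ, ⨆ y ∈ Metric.ball x (1 / ((n : ℝ) + 1)), absSlope f x y := by
    rw [gradNorm_eq_limsup_nhds, Metric.nhds_basis_ball_inv_nat_succ.limsup_eq_iInf_iSup]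
    simp
  rw [funext gradNorm_eq_iInf]
  exact Measurable.iInf fun n => (lowerSemicontinuous_iSup_ball_absSlope hf _).measurable

end GradNorm

section MeanValue

theorem sub_le_of_gradNorm_le_on_Icc {v : ℝ → ℝ} {a b : ℝ} (hab : a ≤ b) {L : ℝ≥0}
    (hv : ∀ t ∈ Set.Icc a b, gradNorm v t ≤ L) : v b - v a ≤ L * (b - a) := by
  have hcont : ContinuousOn v (Set.Icc a b) := fun t ht =>
    (continuousAt_of_gradNorm_ne_top (ne_top_of_le_ne_top ENNReal.coe_ne_top
      (hv t ht))).continuousWithinAt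
  have hline (t : ℝ) : HasDerivAt (fun s => v a + L * (s - a)) L t := by
    simpa using (((hasDerivAt_id t).sub_const a).const_mul (L : ℝ)).const_add (v a)
  have hslope : ∀ t ∈ Set.Ico a b, ∀ r, (L : ℝ) < r → ∃ᶠ z in 𝓝[>] t, slope v t z < r := by
    intro t ht r hr
    obtain ⟨L', hLL', hL'r⟩ := exists_between hr
    lift L' to ℝ≥0 using L.coe_nonneg.trans hLL'.le
    have hinc := gradNorm_le_coe_iff.1 (hv t (Set.Ico_subset_Icc_self ht)) L' (mod_cast hLL')
    refine Eventually.frequently ?_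
    filter_upwards [hinc.filter_mono nhdsWithin_le_nhds, self_mem_nhdsWithin] with z hz htz
    have htz' : 0 < z - t := sub_pos.2 htz
    rw [Real.dist_eq, abs_of_pos htz'] at hz
    rw [slope_def_field, div_lt_iff₀ htz']
    exact ((le_abs_self _).trans hz).trans_lt (mul_lt_mul_of_pos_right hL'r htz')
  have := image_le_of_liminf_slope_right_le_deriv_boundary (B := fun s => v a + L * (s - a))
    hcont (by simp) (by fun_prop) (fun t _ => (hline t).hasDerivWithinAt) hslope
    (Set.right_mem_Icc.2 hab)
  linarith

variable {E : Type*} [NormedAddCommGroup E] [NormedSpace ℝ E] {v : E → ℝ} {x y : E}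

theorem abs_sub_le_of_gradNorm_le_on_segment {L : ℝ≥0}
    (hv : ∀ z ∈ segment ℝ x y, gradNorm v z ≤ L) : |v y - v x| ≤ L * dist y x := by
  wlog hxy : v x ≤ v y generalizing x y
  · rw [abs_sub_comm, dist_comm]
    exact this (segment_symm ℝ x y ▸ hv) (le_of_not_ge hxy)
  have hcomp : ∀ t ∈ Set.Icc (0 : ℝ) 1,
      gradNorm (v ∘ AffineMap.lineMap x y) t ≤ (nndist x y * L : ℝ≥0) := fun t ht => by
    rw [ENNReal.coe_mul]
    refine (gradNorm_comp_le (lipschitzWith_lineMap x y) v t).trans ?_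
    gcongr
    exact hv _ (segment_eq_image_lineMap ℝ x y ▸ Set.mem_image_of_mem _ ht)
  rw [abs_of_nonneg (sub_nonneg.2 hxy)]
  simpa [dist_comm, mul_comm] using sub_le_of_gradNorm_le_on_Icc zero_le_one hcomp

theorem abs_sub_le_of_gradNorm_le_of_lipschitzWith {g : E → ℝ≥0} {K : ℝ≥0}
    (hg : LipschitzWith K g) (hv : ∀ z, gradNorm v z ≤ g z) (x y : E) :
    |v y - v x| ≤ (g x + K * dist y x) * dist y x := by
  have hsegment : ∀ z ∈ segment ℝ x y, gradNorm v z ≤ (g x + K * nndist y x : ℝ≥0) := by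
    intro z hz
    refine (hv z).trans (ENNReal.coe_le_coe.2 (NNReal.coe_le_coe.1 ?_))
    have hzx : dist z x ≤ dist y x := dist_comm x y ▸ segment_subset_closedBall_left x y hz
    calc (g z : ℝ) ≤ g x + K * dist z x := by
          simpa using (NNReal.isometry_coe.lipschitz.comp hg).le_add_mul z x
      _ ≤ g x + K * dist y x := by gcongr
  simpa using abs_sub_le_of_gradNorm_le_on_segment hsegment

end MeanValue

section Ekeland

variable {X : Type*} [MetricSpace X] {Ψ : X → ℝ} {κ : ℝ} {x y : X}

/-- The points to which one descends from `x` at average slope at least `κ`; this is the partial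
order of Ekeland's variational principle. -/
def descentSet (Ψ : X → ℝ) (κ : ℝ) (x : X) : Set X := {y | Ψ y + κ * dist y x ≤ Ψ x}

theorem mem_descentSet : y ∈ descentSet Ψ κ x ↔ Ψ y + κ * dist y x ≤ Ψ x := Iff.rfl

theorem self_mem_descentSet (Ψ : X → ℝ) (κ : ℝ) (x : X) : x ∈ descentSet Ψ κ x := by
  simp [mem_descentSet]

theorem descentSet_subset (hκ : 0 ≤ κ) (hy : y ∈ descentSet Ψ κ x) :
    descentSet Ψ κ y ⊆ descentSet Ψ κ x := by
  intro z hz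
  rw [mem_descentSet] at *
  nlinarith [dist_triangle z y x]

theorem isClosed_descentSet (hΨ : LowerSemicontinuous Ψ) (κ : ℝ) (x : X) :
    IsClosed (descentSet Ψ κ x) := by
  have : LowerSemicontinuous fun y => Ψ y + κ * dist y x :=
    hΨ.add (Continuous.lowerSemicontinuous (by fun_prop))
  exact this.isClosed_preimage (Ψ x)

theorem exists_mem_descentSet_subset_closedBall (hΨ : BddBelow (Set.range Ψ)) (hκ : 0 < κ) {ε : ℝ}
    (hε : 0 < ε) (x : X) :
    ∃ y ∈ descentSet Ψ κ x, descentSet Ψ κ y ⊆ Metric.closedBall y ε := by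
  obtain ⟨_, ⟨y, hy, rfl⟩, hlt⟩ := exists_lt_of_csInf_lt
    (Set.Nonempty.image Ψ ⟨x, self_mem_descentSet Ψ κ x⟩)
    (lt_add_of_pos_right (sInf (Ψ '' descentSet Ψ κ x)) (mul_pos hκ hε))
  refine ⟨y, hy, fun z hz => ?_⟩
  have hinf : sInf (Ψ '' descentSet Ψ κ x) ≤ Ψ z :=
    csInf_le (hΨ.mono (Set.image_subset_range _ _))
      (Set.mem_image_of_mem Ψ (descentSet_subset hκ.le hy hz))
  have hdrop := mem_descentSet.1 hz
  exact le_of_mul_le_mul_left (by linarith) hκ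

/-- Ekeland's variational principle. -/
theorem exists_descentSet_eq_singleton [CompleteSpace X] (hΨ : LowerSemicontinuous Ψ)
    (hbdd : BddBelow (Set.range Ψ)) (hκ : 0 < κ) (x₀ : X) :
    ∃ x ∈ descentSet Ψ κ x₀, descentSet Ψ κ x = {x} := by
  have hε (n : ℕ) : (0 : ℝ) < 1 / (n + 1) := by positivity
  choose next hnext hball using fun n => exists_mem_descentSet_subset_closedBall hbdd hκ (hε n)
  let a (n : ℕ) : X := Nat.rec x₀ next n
  let s (n : ℕ) : Set X := descentSet Ψ κ (a (n + 1))
  have hs : Antitone s := antitone_nat_of_succ_le fun n => descentSet_subset hκ.le (hnext _ _)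
  have hsball (n : ℕ) : s n ⊆ Metric.closedBall (a (n + 1)) (1 / (n + 1)) := hball n (a n)
  have hdiam : Tendsto (fun n => Metric.diam (s n)) atTop (𝓝 0) := by
    refine squeeze_zero (fun _ => Metric.diam_nonneg)
      (fun n => Metric.diam_le_of_subset_closedBall (hε n).le (hsball n)) ?_
    simpa using tendsto_one_div_add_atTop_nhds_zero_nat.const_mul (2 : ℝ)
  have hsbdd (n : ℕ) : Bornology.IsBounded (s n) := Metric.isBounded_closedBall.subset (hsball n)
  obtain ⟨x, hx⟩ : (⋂ n, s n).Nonempty :=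
    Metric.nonempty_iInter_of_nonempty_biInter (fun n => isClosed_descentSet hΨ κ _) hsbdd
      (fun N => ⟨a (N + 1), Set.mem_iInter₂.2 fun n hn => hs hn (self_mem_descentSet Ψ κ _)⟩) hdiam
  rw [Set.mem_iInter] at hx
  refine ⟨x, descentSet_subset hκ.le (hnext 0 x₀) (hx 0), Set.eq_singleton_iff_unique_mem.2
    ⟨self_mem_descentSet Ψ κ x, fun y hy => dist_le_zero.1 (ge_of_tendsto' hdiam fun n => ?_)⟩⟩
  exact Metric.dist_le_diam_of_mem (hsbdd n) (descentSet_subset hκ.le (hx n) hy) (hx n)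

end Ekeland

section LipschitzRegularization

variable {X : Type*} [PseudoMetricSpace X] {h : X → ℝ≥0∞} {k : ℕ} {x : X}

/-- The Lipschitz regularization `min (k, inf_y (h y + k d(y, x)))` of `h`; the truncation at `k`
makes it finite. -/
noncomputable def lipApprox (h : X → ℝ≥0∞) (k : ℕ) (x : X) : ℝ≥0 :=
  (min (k : ℝ≥0∞) (⨅ y, h y + k * edist y x)).toNNReal

theorem coe_lipApprox (h : X → ℝ≥0∞) (k : ℕ) (x : X) :
    (lipApprox h k x : ℝ≥0∞) = min (k : ℝ≥0∞) (⨅ y, h y + k * edist y x) :=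
  ENNReal.coe_toNNReal (ne_top_of_le_ne_top (ENNReal.natCast_ne_top k) (min_le_left _ _))

theorem lipApprox_le_natCast (h : X → ℝ≥0∞) (k : ℕ) (x : X) : lipApprox h k x ≤ k := by
  rw [← ENNReal.coe_le_coe, coe_lipApprox]
  exact min_le_left _ _

theorem coe_lipApprox_le (h : X → ℝ≥0∞) (k : ℕ) (x : X) : (lipApprox h k x : ℝ≥0∞) ≤ h x := by
  rw [coe_lipApprox]
  exact (min_le_right _ _).trans ((iInf_le _ x).trans (by simp))

theorem lipApprox_mono (h : X → ℝ≥0∞) : Monotone (lipApprox h) := by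
  intro j k hjk x
  rw [← ENNReal.coe_le_coe, coe_lipApprox, coe_lipApprox]
  gcongr

theorem lipschitzWith_lipApprox (h : X → ℝ≥0∞) (k : ℕ) : LipschitzWith k (lipApprox h k) := by
  have hle (x y : X) : lipApprox h k x ≤ lipApprox h k y + k * nndist x y := by
    rw [← ENNReal.coe_le_coe]
    push_cast
    rw [coe_lipApprox, coe_lipApprox, ← min_add_add_right, ENNReal.iInf_add]
    refine min_le_min le_self_add (iInf_mono fun z => ?_)
    rw [add_assoc, ← mul_add, edist_comm x y]
    gcongr
    exact edist_triangle _ _ _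
  exact LipschitzWith.of_dist_le_mul fun x y =>
    (LipschitzWith.of_le_add_mul (k : ℝ≥0) fun x y => mod_cast hle x y).dist_le_mul x y

theorem exists_ball_forall_le_lipApprox (hh : LowerSemicontinuous h) {m : ℝ≥0} (hm : m < h x) :
    ∃ ρ > 0, ∀ᶠ k in atTop, ∀ y ∈ Metric.ball x ρ, m ≤ lipApprox h k y := by
  obtain ⟨ρ, hρ, hball⟩ := Metric.eventually_nhds_iff.1 (hh x _ hm)
  refine ⟨ρ / 2, half_pos hρ, ?_⟩
  filter_upwards [tendsto_natCast_atTop_atTop.eventually_ge_atTop m,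
    (tendsto_natCast_atTop_atTop.atTop_mul_const (half_pos hρ)).eventually_ge_atTop (m : ℝ)]
    with k hmk hmkρ y hy
  rw [← ENNReal.coe_le_coe, coe_lipApprox]
  refine le_min (mod_cast hmk) (le_iInf fun z => ?_)
  rcases lt_or_ge (dist z x) ρ with hz | hz
  · exact (hball hz).le.trans le_self_add
  · have hzy : ρ / 2 ≤ dist z y := by linarith [dist_triangle z y x, Metric.mem_ball.1 hy]
    have hmzy : (m : ℝ) ≤ k * dist z y := hmkρ.trans (by gcongr)
    calc (m : ℝ≥0∞) ≤ k * edist z y := by rw [edist_nndist]; exact_mod_cast hmzy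
      _ ≤ h z + k * edist z y := le_add_self

theorem exists_near_of_lipApprox_lt {c : ℝ≥0} (hck : c ≤ k) (hc : lipApprox h k x < c) :
    ∃ z, h z ≤ c ∧ k * dist z x ≤ c := by
  rw [← ENNReal.coe_lt_coe, coe_lipApprox, min_lt_iff] at hc
  obtain ⟨z, hz⟩ := iInf_lt_iff.1 (hc.resolve_left (not_lt.2 (mod_cast hck)))
  refine ⟨z, le_self_add.trans hz.le, ?_⟩
  have hdist : k * edist z x ≤ c := le_add_self.trans hz.le
  rw [edist_nndist] at hdist
  exact_mod_cast hdist

theorem exists_tendsto_subseq_of_lipApprox_lt {c : ℝ≥0} (hcpt : IsCompact {z | h z ≤ c})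
    {y : ℕ → X} (hy : ∀ᶠ k in atTop, lipApprox h k (y k) < c) :
    ∃ p, ∃ φ : ℕ → ℕ, StrictMono φ ∧ Tendsto (y ∘ φ) atTop (𝓝 p) := by
  have : Nonempty X := ⟨y 0⟩
  have hnear : ∀ᶠ k in atTop, ∃ z, h z ≤ c ∧ k * dist z (y k) ≤ c := by
    filter_upwards [hy, tendsto_natCast_atTop_atTop.eventually_ge_atTop c] with k hk hck
    exact exists_near_of_lipApprox_lt hck hk
  obtain ⟨z, hz⟩ := hnear.choice
  obtain ⟨p, -, φ, hφ, hzp⟩ := hcpt.tendsto_subseq' (hz.mono fun k hk => hk.1).frequently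
  have hzy : Tendsto (fun k => dist (z k) (y k)) atTop (𝓝 0) := by
    refine squeeze_zero' (Eventually.of_forall fun _ => dist_nonneg) ?_
      (tendsto_const_div_atTop_nhds_zero_nat (c : ℝ))
    filter_upwards [hz, eventually_gt_atTop 0] with k hk hk0
    rw [le_div_iff₀ (mod_cast hk0), mul_comm]
    exact hk.2
  exact ⟨p, φ, hφ, tendsto_of_tendsto_of_dist hzp (hzy.comp hφ.tendsto_atTop)⟩

end LipschitzRegularization

section SkirtedCone

variable {X : Type*} [MetricSpace X] {x y : X} {a ρ : ℝ} {m c : ℝ≥0}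

/-- The cone with apex `(x, a)` and slope `m`, which falls off more steeply, with slope `m + c`,
outside the ball of radius `ρ` about `x`. -/
noncomputable def skirtedCone (x : X) (a : ℝ) (m c : ℝ≥0) (ρ : ℝ) (y : X) : ℝ :=
  a - m * dist y x - c * max (dist y x - ρ) 0

theorem skirtedCone_self (hρ : 0 ≤ ρ) : skirtedCone x a m c ρ x = a := by
  simp [skirtedCone, hρ]

theorem skirtedCone_le : skirtedCone x a m c ρ y ≤ a - m * dist y x :=
  sub_le_self _ (by positivity)

theorem skirtedCone_le_sub_mul : skirtedCone x a m c ρ y ≤ a - c * (dist y x - ρ) := by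
  have hcone : 0 ≤ m * dist y x := by positivity
  have hskirt : c * (dist y x - ρ) ≤ c * max (dist y x - ρ) 0 := by gcongr; exact le_max_left _ _
  unfold skirtedCone
  linarith

theorem lipschitzWith_skirtedCone : LipschitzWith (m + c) (skirtedCone x a m c ρ) := by
  refine LipschitzWith.of_le_add_mul _ fun y z => ?_
  have hcone : m * dist z x ≤ m * (dist y x + dist y z) := by
    gcongr
    linarith [dist_triangle_left z x y]
  have hskirt : c * max (dist z x - ρ) 0 ≤ c * (max (dist y x - ρ) 0 + dist y z) := by
    gcongr
    refine max_le ?_ (by positivity)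
    linarith [dist_triangle_left z x y, le_max_left (dist y x - ρ) 0]
  unfold skirtedCone
  push_cast
  linarith

theorem gradNorm_skirtedCone_le_of_dist_lt (hy : dist y x < ρ) :
    gradNorm (skirtedCone x a m c ρ) y ≤ m := by
  have hnear : ∀ᶠ z in 𝓝 y, dist z x < ρ :=
    (continuous_id.dist continuous_const).continuousAt.eventually_lt_const hy
  have hcone : skirtedCone x a m c ρ =ᶠ[𝓝 y] skirtedCone x a m 0 ρ := by
    filter_upwards [hnear] with z hz
    simp [skirtedCone, hz.le]
  rw [gradNorm_congr hcone]
  simpa using gradNorm_le_of_lipschitzWith (lipschitzWith_skirtedCone (c := 0)) y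

end SkirtedCone

section SlopeEnvelope

variable {X : Type*} [MetricSpace X] {f v w : X → ℝ} {g g' : X → ℝ≥0} {b : ℝ} {x : X}

/-- The functions between the constant `b` and `f` whose slope is at most `g`. -/
def slopeMinorants (f : X → ℝ) (g : X → ℝ≥0) (b : ℝ) : Set (X → ℝ) :=
  {v | (∀ x, b ≤ v x) ∧ (∀ x, v x ≤ f x) ∧ ∀ x, gradNorm v x ≤ g x}

/-- The largest function between the constant `b` and `f` whose slope is at most `g`. -/
noncomputable def slopeEnvelope (f : X → ℝ) (g : X → ℝ≥0) (b : ℝ) (x : X) : ℝ :=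
  ⨆ v : slopeMinorants f g b, v.1 x

theorem const_mem_slopeMinorants (hf : ∀ x, b ≤ f x) : (fun _ => b) ∈ slopeMinorants f g b := by
  refine ⟨fun _ => le_rfl, hf, fun x => ?_⟩
  exact (gradNorm_le_of_lipschitzWith (LipschitzWith.const b) x).trans (by simp)

theorem slopeMinorants_subset (hgg' : g ≤ g') : slopeMinorants f g b ⊆ slopeMinorants f g' b :=
  fun _ hv => ⟨hv.1, hv.2.1, fun x => (hv.2.2 x).trans (ENNReal.coe_le_coe.2 (hgg' x))⟩

theorem continuous_of_mem_slopeMinorants (hv : v ∈ slopeMinorants f g b) : Continuous v :=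
  continuous_of_gradNorm_ne_top fun x => ne_top_of_le_ne_top ENNReal.coe_ne_top (hv.2.2 x)

theorem max_mem_slopeMinorants (hv : v ∈ slopeMinorants f g b) (hw : Continuous w)
    (hwf : ∀ x, w x ≤ f x) (hwg : ∀ x, v x ≤ w x → gradNorm w x ≤ g x) :
    (fun x => max (v x) (w x)) ∈ slopeMinorants f g b :=
  ⟨fun x => (hv.1 x).trans (le_max_left _ _), fun x => max_le (hv.2.1 x) (hwf x), fun x =>
    gradNorm_max_le (continuous_of_mem_slopeMinorants hv) hw (hv.2.2 x) (hwg x)⟩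

theorem le_slopeEnvelope (hv : v ∈ slopeMinorants f g b) (x : X) : v x ≤ slopeEnvelope f g b x :=
  le_ciSup (f := fun v : slopeMinorants f g b => v.1 x)
    ⟨f x, Set.forall_mem_range.2 fun v => v.2.2.1 x⟩ ⟨v, hv⟩

theorem slopeEnvelope_le_of_forall (hf : ∀ x, b ≤ f x) {t : ℝ}
    (ht : ∀ v ∈ slopeMinorants f g b, v x ≤ t) : slopeEnvelope f g b x ≤ t :=
  have : Nonempty (slopeMinorants f g b) := ⟨⟨_, const_mem_slopeMinorants hf⟩⟩
  ciSup_le fun v => ht v.1 v.2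

theorem slopeEnvelope_mono (hf : ∀ x, b ≤ f x) (hgg' : g ≤ g') (x : X) :
    slopeEnvelope f g b x ≤ slopeEnvelope f g' b x :=
  slopeEnvelope_le_of_forall hf fun _ hv => le_slopeEnvelope (slopeMinorants_subset hgg' hv) x

theorem slopeEnvelope_le (hf : ∀ x, b ≤ f x) (x : X) : slopeEnvelope f g b x ≤ f x :=
  slopeEnvelope_le_of_forall hf fun _ hv => hv.2.1 x

theorem le_slopeEnvelope_const (hf : ∀ x, b ≤ f x) (x : X) : b ≤ slopeEnvelope f g b x :=
  le_slopeEnvelope (const_mem_slopeMinorants hf) x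

theorem slopeEnvelope_lipApprox_mono (hf : ∀ x, b ≤ f x) (h : X → ℝ≥0∞) :
    Monotone fun k => slopeEnvelope f (lipApprox h k) b :=
  fun _ _ hjk => slopeEnvelope_mono hf (lipApprox_mono h hjk)

theorem bddAbove_range_slopeEnvelope_lipApprox (hf : ∀ x, b ≤ f x) (h : X → ℝ≥0∞) (x : X) :
    BddAbove (Set.range fun k => slopeEnvelope f (lipApprox h k) b x) :=
  ⟨f x, Set.forall_mem_range.2 fun _ => slopeEnvelope_le hf x⟩

end SlopeEnvelope

section SlopeEnvelopeNormed

variable {E : Type*} [NormedAddCommGroup E] [NormedSpace ℝ E] {f : E → ℝ} {g : E → ℝ≥0} {b : ℝ}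
  {K : ℝ≥0}

theorem abs_slopeEnvelope_sub_le (hf : ∀ x, b ≤ f x) (hg : LipschitzWith K g) (x y : E) :
    |slopeEnvelope f g b y - slopeEnvelope f g b x| ≤ (g x + 2 * K * dist y x) * dist y x := by
  have hinc (x y : E) : slopeEnvelope f g b y ≤
      slopeEnvelope f g b x + (g x + K * dist y x) * dist y x :=
    slopeEnvelope_le_of_forall hf fun v hv => by
      linarith [le_slopeEnvelope hv x, (abs_le.1
        (abs_sub_le_of_gradNorm_le_of_lipschitzWith hg hv.2.2 x y)).2]
  have hgy : g y * dist y x ≤ (g x + K * dist y x) * dist y x := by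
    gcongr
    simpa using (NNReal.isometry_coe.lipschitz.comp hg).le_add_mul y x
  have hyx := hinc y x
  rw [dist_comm x y] at hyx
  have hK : 0 ≤ K * dist y x * dist y x := by positivity
  rw [abs_sub_le_iff]
  constructor <;> linarith [hinc x y]

theorem slopeEnvelope_mem_slopeMinorants (hf : ∀ x, b ≤ f x) (hg : LipschitzWith K g) :
    slopeEnvelope f g b ∈ slopeMinorants f g b := by
  refine ⟨le_slopeEnvelope_const hf, slopeEnvelope_le hf, fun x => ?_⟩
  refine gradNorm_le_coe_iff.2 fun L hL => ?_
  have hlim : Tendsto (fun y => g x + 2 * K * dist y x) (𝓝 x) (𝓝 (g x)) :=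
    Continuous.tendsto' (by fun_prop) _ _ (by simp)
  filter_upwards [hlim.eventually_lt_const (NNReal.coe_lt_coe.2 hL)] with y hy
  exact (abs_slopeEnvelope_sub_le hf hg x y).trans (by gcongr)

-- Otherwise raising the envelope to the cone would give a larger admissible function.
theorem exists_slopeEnvelope_le (hf : ∀ x, b ≤ f x) (hg : LipschitzWith K g) {x : E} {m c : ℝ≥0}
    {r δ : ℝ} (hr : 0 < r) (hδ : 0 < δ) (hc : f x - b < c * (r / 2))
    (hfx : ∀ y, dist y x ≤ r → f x - m * dist y x ≤ f y) (hgx : ∀ y, dist y x ≤ r → m ≤ g y)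
    (hδf : slopeEnvelope f g b x + δ ≤ f x) :
    ∃ y, r / 2 ≤ dist y x ∧ dist y x ≤ r ∧ g y < m + c ∧
      slopeEnvelope f g b y ≤ slopeEnvelope f g b x + δ - m * dist y x := by
  by_contra! habove
  set u := slopeEnvelope f g b
  set w := skirtedCone x (u x + δ) m c (r / 2) with hw
  have humem : u ∈ slopeMinorants f g b := slopeEnvelope_mem_slopeMinorants hf hg
  have hw_le (y : E) : w y ≤ u x + δ - m * dist y x := skirtedCone_le
  have hw_far (y : E) (hy : r < dist y x) : w y < b := by
    have hskirt : c * (r / 2) ≤ c * (dist y x - r / 2) := by gcongr; linarith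
    have : w y ≤ u x + δ - c * (dist y x - r / 2) := skirtedCone_le_sub_mul
    linarith
  have hwf (y : E) : w y ≤ f y := by
    rcases le_or_gt (dist y x) r with hy | hy
    · linarith [hw_le y, hfx y hy]
    · linarith [hw_far y hy, hf y]
  have hwg (y : E) (huw : u y ≤ w y) : gradNorm w y ≤ g y := by
    have hy : dist y x ≤ r := by
      by_contra! hy
      linarith [hw_far y hy, humem.1 y]
    rcases lt_or_ge (dist y x) (r / 2) with hy2 | hy2
    · exact (gradNorm_skirtedCone_le_of_dist_lt hy2).trans (ENNReal.coe_le_coe.2 (hgx y hy))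
    · have hgy : m + c ≤ g y := by
        by_contra! hlt
        linarith [hw_le y, habove y hy2 hy hlt]
      exact (gradNorm_le_of_lipschitzWith lipschitzWith_skirtedCone y).trans
        (ENNReal.coe_le_coe.2 hgy)
  have hraised : w x ≤ u x := (le_max_right _ _).trans (le_slopeEnvelope
    (max_mem_slopeMinorants humem lipschitzWith_skirtedCone.continuous hwf hwg) x)
  rw [hw, skirtedCone_self (by positivity)] at hraised
  linarith

end SlopeEnvelopeNormed

theorem iSup_apply_le_of_tendsto {X ι κ : Type*} [TopologicalSpace X] [Preorder ι] [Nonempty ι]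
    {l : Filter κ} [NeBot l] {u : ι → X → ℝ} (hmono : Monotone u) (hcont : ∀ i, Continuous (u i))
    {φ : κ → ι} (hφ : Tendsto φ l atTop) {y : κ → X} {p : X} (hy : Tendsto y l (𝓝 p))
    {t : κ → ℝ} {T : ℝ} (ht : Tendsto t l (𝓝 T)) (hle : ∀ᶠ k in l, u (φ k) (y k) ≤ t k) :
    ⨆ i, u i p ≤ T := by
  refine ciSup_le fun i => le_of_tendsto_of_tendsto (((hcont i).tendsto p).comp hy) ht ?_
  filter_upwards [hle, hφ.eventually_ge_atTop i] with k hk hik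
  exact (hmono hik (y k)).trans hk

section SlopeEnvelopeLimit

variable {E : Type*} [NormedAddCommGroup E] [NormedSpace ℝ E] {f : E → ℝ} {h : E → ℝ≥0∞} {b : ℝ}

theorem continuous_slopeEnvelope_lipApprox (hf : ∀ x, b ≤ f x) (h : E → ℝ≥0∞) (k : ℕ) :
    Continuous (slopeEnvelope f (lipApprox h k) b) :=
  continuous_of_mem_slopeMinorants
    (slopeEnvelope_mem_slopeMinorants hf (lipschitzWith_lipApprox h k))

theorem exists_iSup_slopeEnvelope_le (hf : ∀ x, b ≤ f x)
    (hcpt : ∀ c : ℝ≥0, IsCompact {z | h z ≤ c}) {x : E} {m : ℝ≥0} {r : ℝ} (hr : 0 < r)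
    (hfx : ∀ y, dist y x ≤ r → f x - m * dist y x ≤ f y)
    (hhx : ∀ᶠ k in atTop, ∀ y, dist y x ≤ r → m ≤ lipApprox h k y)
    (hlt : ⨆ k, slopeEnvelope f (lipApprox h k) b x < f x) :
    ∃ p, r / 2 ≤ dist p x ∧ dist p x ≤ r ∧ ⨆ k, slopeEnvelope f (lipApprox h k) b p ≤
      (⨆ k, slopeEnvelope f (lipApprox h k) b x) - m * dist p x := by
  set u : ℕ → E → ℝ := fun k => slopeEnvelope f (lipApprox h k) b
  set U : E → ℝ := fun z => ⨆ k, u k z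
  have huU (k : ℕ) : u k x ≤ U x := le_ciSup (bddAbove_range_slopeEnvelope_lipApprox hf h x) k
  obtain ⟨c, hc⟩ : ∃ c : ℝ≥0, f x - b < c * (r / 2) :=
    (NNReal.tendsto_coe_atTop.2 tendsto_id |>.atTop_mul_const (half_pos hr)).eventually_gt_atTop
      (f x - b) |>.exists
  have hgap : Tendsto (fun k : ℕ => (f x - U x) / (k + 1 : ℝ)) atTop (𝓝 0) :=
    (tendsto_const_div_atTop_nhds_zero_nat (f x - U x)).comp (tendsto_add_atTop_nat 1) |>.congr
      (by simp)
  have hbelow : ∀ᶠ k in atTop, ∃ y, r / 2 ≤ dist y x ∧ dist y x ≤ r ∧ lipApprox h k y < m + c ∧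
      u k y ≤ U x + (f x - U x) / (k + 1 : ℝ) - m * dist y x := by
    filter_upwards [hhx] with k hk
    have hgap0 : 0 < f x - U x := sub_pos.2 hlt
    have hgap_le : (f x - U x) / (k + 1 : ℝ) ≤ f x - U x := div_le_self hgap0.le (by simp)
    obtain ⟨y, hy1, hy2, hgy, huy⟩ := exists_slopeEnvelope_le hf (lipschitzWith_lipApprox h k) hr
      (by positivity : 0 < (f x - U x) / (k + 1 : ℝ)) hc hfx hk (by linarith [huU k])
    exact ⟨y, hy1, hy2, hgy, huy.trans (by linarith [huU k])⟩
  obtain ⟨y, hy⟩ := hbelow.choice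
  obtain ⟨p, φ, hφ, hyp⟩ := exists_tendsto_subseq_of_lipApprox_lt (hcpt (m + c))
    (hy.mono fun k hk => hk.2.2.1)
  have hyφ := hφ.tendsto_atTop.eventually hy
  have hdist : Tendsto (fun k => dist (y (φ k)) x) atTop (𝓝 (dist p x)) :=
    hyp.dist tendsto_const_nhds
  refine ⟨p, ge_of_tendsto hdist (hyφ.mono fun k hk => hk.1),
    le_of_tendsto hdist (hyφ.mono fun k hk => hk.2.1), ?_⟩
  refine iSup_apply_le_of_tendsto (slopeEnvelope_lipApprox_mono hf h)
    (continuous_slopeEnvelope_lipApprox hf h) hφ.tendsto_atTop hyp ?_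
    (hyφ.mono fun k hk => hk.2.2.2)
  simpa using ((hgap.comp hφ.tendsto_atTop).const_add (U x)).sub (hdist.const_mul (m : ℝ))

theorem exists_ne_mem_descentSet_iSup_slopeEnvelope_sub (hf : ∀ x, b ≤ f x) {κ : ℝ≥0} (hκ : 0 < κ)
    (hh : LowerSemicontinuous h) (hcpt : ∀ c : ℝ≥0, IsCompact {z | h z ≤ c}) {x : E}
    (hgf : gradNorm f x ≠ ∞) (hfh : gradNorm f x + κ ≤ h x)
    (hlt : ⨆ k, slopeEnvelope f (lipApprox h k) b x < f x) :
    ∃ p ≠ x, p ∈ descentSet (fun z => (⨆ k, slopeEnvelope f (lipApprox h k) b z) - f z)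
      (κ / 2) x := by
  lift gradNorm f x to ℝ≥0 using hgf with γ hγ
  have hfx := gradNorm_le_coe_iff.1 hγ.ge (γ + κ / 4) (lt_add_of_pos_right γ (by positivity))
  have hmh : ((γ + 3 * κ / 4 : ℝ≥0) : ℝ≥0∞) < h x := by
    refine lt_of_lt_of_le ?_ hfh
    rw [← ENNReal.coe_add, ENNReal.coe_lt_coe, ← NNReal.coe_lt_coe]
    push_cast
    linarith [NNReal.coe_pos.2 hκ]
  obtain ⟨ρ, hρ, hhx⟩ := exists_ball_forall_le_lipApprox hh hmh
  obtain ⟨r₀, hr₀, hfx⟩ := Metric.eventually_nhds_iff.1 hfx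
  obtain ⟨r, hr, hrlt⟩ := exists_between (lt_min hρ hr₀)
  obtain ⟨hrρ, hrr₀⟩ := lt_min_iff.1 hrlt
  have hfx (y : E) (hy : dist y x ≤ r) : f x - (γ + κ / 4) * dist y x ≤ f y := by
    have := (abs_le.1 (hfx (hy.trans_lt hrr₀))).1
    push_cast at this
    linarith
  have hκdist (y : E) : 0 ≤ κ * dist y x := by positivity
  obtain ⟨p, hrp, hpr, hp⟩ := exists_iSup_slopeEnvelope_le hf hcpt hr
    (fun y hy => by push_cast; linarith [hfx y hy, hκdist y])
    (hhx.mono fun k hk y hy => hk y (hy.trans_lt hrρ)) hlt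
  refine ⟨p, dist_pos.1 ((half_pos hr).trans_le hrp), mem_descentSet.2 ?_⟩
  push_cast at hp
  linarith [hfx p hpr]

variable [CompleteSpace E]

-- At a point chosen by Ekeland's principle, `f - sup_k u_k` cannot grow as fast as the previous
-- lemma forces it to.
theorem tendsto_slopeEnvelope_lipApprox (hb : ∀ x, b ≤ f x) (hbdd : BddAbove (Set.range f))
    (hgf : ∀ x, gradNorm f x ≠ ∞) {κ : ℝ≥0} (hκ : 0 < κ) (hh : LowerSemicontinuous h)
    (hfh : ∀ x, gradNorm f x + κ ≤ h x) (hcpt : ∀ c : ℝ≥0, IsCompact {z | h z ≤ c}) (x : E) :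
    Tendsto (fun k => slopeEnvelope f (lipApprox h k) b x) atTop (𝓝 (f x)) := by
  set U : E → ℝ := fun x => ⨆ k, slopeEnvelope f (lipApprox h k) b x
  have hUbdd := bddAbove_range_slopeEnvelope_lipApprox hb h
  have hUf (x : E) : U x ≤ f x := ciSup_le fun k => slopeEnvelope_le hb x
  have hbU (x : E) : b ≤ U x := (le_slopeEnvelope_const hb x).trans (le_ciSup (hUbdd x) 0)
  suffices hfU : ∀ x, f x ≤ U x by
    rw [le_antisymm (hfU x) (hUf x)]
    exact tendsto_atTop_ciSup (fun _ _ hjk => slopeEnvelope_lipApprox_mono hb h hjk x) (hUbdd x)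
  by_contra! hcon
  obtain ⟨x₀, hx₀⟩ := hcon
  have hlsc : LowerSemicontinuous fun x => U x - f x := by
    simp only [sub_eq_add_neg]
    exact (lowerSemicontinuous_ciSup hUbdd fun k =>
      (continuous_slopeEnvelope_lipApprox hb h k).lowerSemicontinuous).add
      (continuous_of_gradNorm_ne_top hgf).neg.lowerSemicontinuous
  have hUfbdd : BddBelow (Set.range fun x => U x - f x) := by
    obtain ⟨B, hB⟩ := hbdd
    exact ⟨b - B, Set.forall_mem_range.2 fun x => sub_le_sub (hbU x) (hB ⟨x, rfl⟩)⟩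
  obtain ⟨x, hxx₀, hx⟩ := exists_descentSet_eq_singleton hlsc hUfbdd
    (half_pos (NNReal.coe_pos.2 hκ)) x₀
  have hUx : U x < f x := by
    have hle := mem_descentSet.1 hxx₀
    have : 0 ≤ κ / 2 * dist x x₀ := by positivity
    linarith
  obtain ⟨p, hpx, hp⟩ := exists_ne_mem_descentSet_iSup_slopeEnvelope_sub hb hκ hh hcpt (hgf x)
    (hfh x) hUx
  exact hpx (Set.mem_singleton_iff.1 (hx.subset hp))

end SlopeEnvelopeLimit

section LowerSemicontinuousMajorant

theorem coe_add_sq_le (a : ℝ≥0∞) (κ : ℝ≥0) : (a + κ) ^ 2 ≤ (1 + κ) * a ^ 2 + (κ + κ ^ 2) := by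
  induction a with
  | top => simp
  | coe a =>
    have hreal : (a + κ) ^ 2 ≤ (1 + κ) * a ^ 2 + (κ + κ ^ 2) := by
      rw [← NNReal.coe_le_coe]
      push_cast
      linarith [mul_nonneg κ.coe_nonneg (sq_nonneg ((a : ℝ) - 1))]
    exact_mod_cast hreal

variable {X : Type*} [MeasurableSpace X] (μ : Measure X) [IsFiniteMeasure μ]

theorem exists_pos_lintegral_add_sq_le {G : X → ℝ≥0∞} (hG : Measurable G)
    (hG2 : ∫⁻ x, G x ^ 2 ∂μ ≠ ∞) {ε : ℝ≥0∞} (hε : ε ≠ 0) :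
    ∃ κ : ℝ≥0, 0 < κ ∧ ∫⁻ x, (G x + κ) ^ 2 ∂μ ≤ ∫⁻ x, G x ^ 2 ∂μ + ε := by
  set I := ∫⁻ x, G x ^ 2 ∂μ
  have hbound (κ : ℝ≥0) :
      ∫⁻ x, (G x + κ) ^ 2 ∂μ ≤ (1 + κ) * I + (κ + κ ^ 2) * μ Set.univ := by
    refine (lintegral_mono fun x => coe_add_sq_le (G x) κ).trans_eq ?_
    rw [lintegral_add_right _ measurable_const, lintegral_const_mul _ (hG.pow_const 2),
      lintegral_const]
  have hlim : Tendsto (fun κ : ℝ≥0 => (1 + κ) * I + (κ + κ ^ 2) * μ Set.univ) (𝓝[>] 0) (𝓝 I) := by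
    have hcont : Continuous fun κ : ℝ≥0 => (1 + κ) * I + (κ + κ ^ 2) * μ Set.univ := by
      refine (ENNReal.continuous_mul_const hG2).comp (by fun_prop) |>.add
        ((ENNReal.continuous_mul_const (measure_ne_top μ _)).comp (by fun_prop))
    exact (hcont.tendsto' 0 I (by simp)).mono_left nhdsWithin_le_nhds
  obtain ⟨κ, hκ, hκ0⟩ :=
    ((hlim.eventually_lt_const (ENNReal.lt_add_right hG2 hε)).and self_mem_nhdsWithin).exists
  exact ⟨κ, hκ0, (hbound κ).trans hκ.le⟩

variable [TopologicalSpace X] [PolishSpace X] [BorelSpace X]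

theorem exists_lowerSemicontinuous_isCompact_sublevel_lintegral_le {ε : ℝ≥0∞} (hε : ε ≠ 0) :
    ∃ H : X → ℝ≥0∞, LowerSemicontinuous H ∧ (∀ c : ℝ≥0, IsCompact {x | H x ≤ c}) ∧
      ∫⁻ x, H x ∂μ ≤ ε := by
  obtain ⟨δ, hδ, hδε⟩ := ENNReal.exists_pos_sum_of_countable' hε ℕ
  choose K hKcpt hKδ using fun j => exists_isCompact_closure_measure_compl_lt μ _ (hδ j)
  have hopen (j : ℕ) : IsOpen (closure (K j))ᶜ := isClosed_closure.isOpen_compl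
  have hlsc : LowerSemicontinuous fun x => ∑' j, (closure (K j))ᶜ.indicator (1 : X → ℝ≥0∞) x :=
    lowerSemicontinuous_tsum fun j => (hopen j).lowerSemicontinuous_indicator zero_le_one
  refine ⟨_, hlsc, fun c => ?_, ?_⟩
  · obtain ⟨N, hN⟩ := exists_nat_gt c
    refine ((Finset.range N).isCompact_biUnion fun j _ => hKcpt j).of_isClosed_subset
      (hlsc.isClosed_preimage c) fun x hx => ?_
    by_contra hcon
    simp only [Set.mem_iUnion, not_exists] at hcon
    have hsum : (N : ℝ≥0∞) ≤ c := by
      refine le_trans ?_ ((ENNReal.sum_le_tsum (Finset.range N)).trans hx)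
      rw [Finset.sum_congr rfl fun j hj => Set.indicator_of_mem (hcon j hj) _]
      simp
    exact hN.not_ge (mod_cast hsum)
  · rw [lintegral_tsum fun j => (measurable_one.indicator (hopen j).measurableSet).aemeasurable]
    refine (ENNReal.tsum_le_tsum fun j => ?_).trans hδε.le
    rw [lintegral_indicator_one (hopen j).measurableSet]
    exact (measure_mono (Set.compl_subset_compl.2 subset_closure)).trans (hKδ j).le

theorem exists_lowerSemicontinuous_add_le_lintegral_sq_le {G : X → ℝ≥0∞} (hG : Measurable G)
    (hG2 : ∫⁻ x, G x ^ 2 ∂μ ≠ ∞) {ε : ℝ≥0∞} (hε : ε ≠ 0) :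
    ∃ κ : ℝ≥0, 0 < κ ∧ ∃ h : X → ℝ≥0∞, LowerSemicontinuous h ∧ (∀ x, G x + κ ≤ h x) ∧
      (∀ c : ℝ≥0, IsCompact {x | h x ≤ c}) ∧ ∫⁻ x, h x ^ 2 ∂μ ≤ ∫⁻ x, G x ^ 2 ∂μ + ε := by
  have hε3 : ε / 3 ≠ 0 := by simpa using hε
  obtain ⟨κ, hκ, hκint⟩ := exists_pos_lintegral_add_sq_le μ hG hG2 hε3
  obtain ⟨H₁, hGH₁, hH₁, hH₁int⟩ := exists_le_lowerSemicontinuous_lintegral_ge μ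
    (fun x => (G x + κ) ^ 2) ((hG.add_const _).pow_const 2) hε3
  obtain ⟨H₂, hH₂, hH₂cpt, hH₂int⟩ := exists_lowerSemicontinuous_isCompact_sublevel_lintegral_le μ
    hε3
  let h (x : X) : ℝ≥0∞ := (H₁ x + H₂ x) ^ (1 / 2 : ℝ)
  have hsq (x : X) : h x ^ 2 = H₁ x + H₂ x := by
    rw [← ENNReal.rpow_natCast, ← ENNReal.rpow_mul]
    norm_num
  have hh : LowerSemicontinuous h :=
    ENNReal.continuous_rpow_const.comp_lowerSemicontinuous (hH₁.add hH₂)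
      (ENNReal.monotone_rpow_of_nonneg (by norm_num))
  refine ⟨κ, hκ, h, hh, fun x => ?_, fun c => ?_, ?_⟩
  · rw [← ENNReal.pow_le_pow_left_iff two_ne_zero, hsq]
    exact (hGH₁ x).trans le_self_add
  · refine (hH₂cpt (c ^ 2)).of_isClosed_subset (hh.isClosed_preimage c) fun x hx => ?_
    calc H₂ x ≤ h x ^ 2 := hsq x ▸ le_add_self
      _ ≤ (c ^ 2 : ℝ≥0) := by rw [ENNReal.coe_pow]; gcongr; exact hx
  · calc ∫⁻ x, h x ^ 2 ∂μ = ∫⁻ x, H₁ x ∂μ + ∫⁻ x, H₂ x ∂μ := by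
          simp only [hsq]
          exact lintegral_add_left hH₁.measurable _
      _ ≤ ∫⁻ x, G x ^ 2 ∂μ + ε / 3 + ε / 3 + ε / 3 := by
          gcongr
          exact hH₁int.trans (by gcongr)
      _ = ∫⁻ x, G x ^ 2 ∂μ + ε := by
          rw [add_assoc, add_assoc, ← add_assoc (ε / 3), ENNReal.add_thirds]

end LowerSemicontinuousMajorant

theorem exists_tendsto_gradNorm_le_lintegral_sq_le {E : Type*} [NormedAddCommGroup E]
    [NormedSpace ℝ E] [CompleteSpace E] [SecondCountableTopology E] [MeasurableSpace E]
    [BorelSpace E] (μ : Measure E) [IsFiniteMeasure μ] {f : E → ℝ} {M : ℝ} (hf : ∀ x, |f x| ≤ M)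
    (hgf : ∀ x, gradNorm f x ≠ ∞) (hf2 : ∫⁻ x, gradNorm f x ^ 2 ∂μ ≠ ∞) {ε : ℝ≥0∞} (hε : ε ≠ 0) :
    ∃ (u : ℕ → E → ℝ) (g : ℕ → E → ℝ≥0), (∀ k x, |u k x| ≤ M) ∧ (∀ k, Continuous (g k)) ∧
      (∀ k x, g k x ≤ k) ∧ (∀ k x, gradNorm (u k) x ≤ g k x) ∧
      (∀ k, ∫⁻ x, (g k x : ℝ≥0∞) ^ 2 ∂μ ≤ ∫⁻ x, gradNorm f x ^ 2 ∂μ + ε) ∧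
      ∀ x, Tendsto (fun k => u k x) atTop (𝓝 (f x)) := by
  obtain ⟨κ, hκ, h, hh, hfh, hcpt, hint⟩ := exists_lowerSemicontinuous_add_le_lintegral_sq_le μ
    (measurable_gradNorm (continuous_of_gradNorm_ne_top hgf)) hf2 hε
  have hlower (x : E) : -M ≤ f x := (abs_le.1 (hf x)).1
  have hupper (x : E) : f x ≤ M := (abs_le.1 (hf x)).2
  have hmem (k : ℕ) := slopeEnvelope_mem_slopeMinorants hlower (lipschitzWith_lipApprox h k)
  refine ⟨fun k => slopeEnvelope f (lipApprox h k) (-M), lipApprox h,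
    fun k x => abs_le.2 ⟨(hmem k).1 x, ((hmem k).2.1 x).trans (hupper x)⟩,
    fun k => (lipschitzWith_lipApprox h k).continuous, lipApprox_le_natCast h,
    fun k => (hmem k).2.2, fun k => ?_, ?_⟩
  · refine (lintegral_mono fun x => ?_).trans hint
    gcongr
    exact coe_lipApprox_le h k x
  · exact tendsto_slopeEnvelope_lipApprox hlower ⟨M, Set.forall_mem_range.2 hupper⟩ hgf hκ hh hfh
      hcpt

section Entropy

open InformationTheory (klFun klFun_nonneg continuous_klFun)

variable {X : Type*} [MeasurableSpace X] {μ : Measure X} {f : X → ℝ} {C : ℝ}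

theorem integrable_and_integral_le_of_tendsto {F : ℕ → X → ℝ} {C : ℕ → ℝ} {c : ℝ}
    (hF : ∀ k, Integrable (F k) μ) (hF0 : ∀ k x, 0 ≤ F k x)
    (hFf : ∀ᵐ x ∂μ, Tendsto (fun k => F k x) atTop (𝓝 (f x)))
    (hFC : ∀ k, ∫ x, F k x ∂μ ≤ C k) (hC : Tendsto C atTop (𝓝 c)) :
    Integrable f μ ∧ ∫ x, f x ∂μ ≤ c := by
  have hf : AEStronglyMeasurable f μ :=
    aestronglyMeasurable_of_tendsto_ae atTop (fun k => (hF k).1) hFf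
  have hf0 : 0 ≤ᵐ[μ] f := hFf.mono fun x hx => ge_of_tendsto' hx fun k => hF0 k x
  have hc : 0 ≤ c := ge_of_tendsto' hC fun k => (integral_nonneg (hF0 k)).trans (hFC k)
  have hlint : ∫⁻ x, ENNReal.ofReal (f x) ∂μ ≤ ENNReal.ofReal c :=
    calc ∫⁻ x, ENNReal.ofReal (f x) ∂μ
        = ∫⁻ x, liminf (fun k => ENNReal.ofReal (F k x)) atTop ∂μ :=
          lintegral_congr_ae <| hFf.mono fun x hx => (ENNReal.tendsto_ofReal hx).liminf_eq.symm
      _ ≤ liminf (fun k => ∫⁻ x, ENNReal.ofReal (F k x) ∂μ) atTop :=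
          lintegral_liminf_le' fun k => (hF k).1.aemeasurable.ennreal_ofReal
      _ ≤ liminf (fun k => ENNReal.ofReal (C k)) atTop := by
          refine liminf_le_liminf (.of_forall fun k => ?_)
          rw [← ofReal_integral_eq_lintegral_ofReal (hF k) (.of_forall (hF0 k))]
          exact ENNReal.ofReal_le_ofReal (hFC k)
      _ = ENNReal.ofReal c := (ENNReal.tendsto_ofReal hC).liminf_eq
  refine ⟨⟨hf, (hasFiniteIntegral_iff_ofReal hf0).2 (hlint.trans_lt ENNReal.ofReal_lt_top)⟩, ?_⟩
  rw [integral_eq_lintegral_of_nonneg_ae hf0 hf]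
  exact ENNReal.toReal_le_of_le_ofReal hc hlint

theorem tendsto_integral_sq_of_dominated {F : ℕ → X → ℝ} {H : X → ℝ}
    (hF : ∀ k, AEStronglyMeasurable (F k) μ) (hH : MemLp H 2 μ) (hFH : ∀ k x, |F k x| ≤ H x)
    (hFf : ∀ x, Tendsto (fun k => F k x) atTop (𝓝 (f x))) :
    Tendsto (fun k => ∫ x, F k x ^ 2 ∂μ) atTop (𝓝 (∫ x, f x ^ 2 ∂μ)) := by
  refine tendsto_integral_of_dominated_convergence (fun x => H x ^ 2) (fun k => (hF k).pow 2)
    hH.integrable_sq (fun k => .of_forall fun x => ?_) (.of_forall fun x => (hFf x).pow 2)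
  rw [norm_pow, Real.norm_eq_abs]
  exact pow_le_pow_left₀ (abs_nonneg _) (hFH k x) 2

/-- The entropy `∫ f² log (f² / ∫ f²) dμ` of `f²` is finite and at most `C`. Integrability is part
of the notion, since the Bochner integral of a non-integrable function is `0`. -/
def EntropyLE (μ : Measure X) (f : X → ℝ) (C : ℝ) : Prop :=
  Integrable (fun x => f x ^ 2 * Real.log (f x ^ 2 / ∫ z, f z ^ 2 ∂μ)) μ ∧
    ∫ x, f x ^ 2 * Real.log (f x ^ 2 / ∫ z, f z ^ 2 ∂μ) ∂μ ≤ C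

theorem EntropyLE.mono {C' : ℝ} (h : EntropyLE μ f C) (hC : C ≤ C') : EntropyLE μ f C' :=
  ⟨h.1, h.2.trans hC⟩

theorem entropyLE_of_forall_lt (h : ∀ C' > C, EntropyLE μ f C') : EntropyLE μ f C :=
  ⟨(h (C + 1) (by simp)).1, le_of_forall_gt_imp_ge_of_dense fun C' hC' => (h C' hC').2⟩

theorem entropyLE_of_integral_sq_eq_zero (hf : ∫ x, f x ^ 2 ∂μ = 0) (hC : 0 ≤ C) :
    EntropyLE μ f C := by
  simpa [EntropyLE, hf] using hC

theorem EntropyLE.comp_of_map {Y : Type*} [MeasurableSpace Y] {ν : Measure Y} {p : Y → X}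
    (hp : AEMeasurable p ν) (hf : AEStronglyMeasurable f (ν.map p))
    (h : EntropyLE (ν.map p) f C) : EntropyLE ν (f ∘ p) C := by
  have hsq : ∫ x, f x ^ 2 ∂(ν.map p) = ∫ y, f (p y) ^ 2 ∂ν := integral_map hp (hf.pow 2)
  obtain ⟨hint, hle⟩ := h
  rw [hsq] at hint hle
  exact ⟨(integrable_map_measure hint.1 hp).1 hint, (integral_map hp hint.1).symm.trans_le hle⟩

/-- The integrand `f² log (f² / s) - f² + s`, where `s = ∫ f² dμ`, which has the same integral as
`f² log (f² / s)` with respect to a probability measure and is nonnegative. -/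
noncomputable def entropyDensity (μ : Measure X) (f : X → ℝ) (x : X) : ℝ :=
  (∫ z, f z ^ 2 ∂μ) * klFun (f x ^ 2 / ∫ z, f z ^ 2 ∂μ)

theorem entropyDensity_nonneg (f : X → ℝ) (x : X) : 0 ≤ entropyDensity μ f x :=
  have hs : 0 ≤ ∫ z, f z ^ 2 ∂μ := integral_nonneg fun z => sq_nonneg (f z)
  mul_nonneg hs (klFun_nonneg (by positivity))

theorem sq_mul_log_ae_eq_entropyDensity (hf : MemLp f 2 μ) :
    (fun x => f x ^ 2 * Real.log (f x ^ 2 / ∫ z, f z ^ 2 ∂μ)) =ᵐ[μ]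
      fun x => entropyDensity μ f x + (f x ^ 2 - ∫ z, f z ^ 2 ∂μ) := by
  by_cases hs : ∫ z, f z ^ 2 ∂μ = 0
  · have hf0 : (fun x => f x ^ 2) =ᵐ[μ] 0 :=
      (integral_eq_zero_iff_of_nonneg (fun x => sq_nonneg (f x)) hf.integrable_sq).1 hs
    filter_upwards [hf0] with x hx
    simp_all [entropyDensity]
  · refine .of_forall fun x => ?_
    simp only [entropyDensity, klFun]
    field

theorem entropyLE_iff [IsProbabilityMeasure μ] (hf : MemLp f 2 μ) :
    EntropyLE μ f C ↔ Integrable (entropyDensity μ f) μ ∧ ∫ x, entropyDensity μ f x ∂μ ≤ C := by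
  have hcongr := sq_mul_log_ae_eq_entropyDensity hf
  have hcent : Integrable (fun x => f x ^ 2 - ∫ z, f z ^ 2 ∂μ) μ :=
    hf.integrable_sq.sub (integrable_const _)
  have hcent0 : ∫ x, (f x ^ 2 - ∫ z, f z ^ 2 ∂μ) ∂μ = 0 := by
    rw [integral_sub hf.integrable_sq (integrable_const _)]
    simp
  rw [EntropyLE, integrable_congr hcongr, integral_congr_ae hcongr,
    integrable_add_iff_integrable_left' hcent]
  refine and_congr_right fun hint => ?_
  rw [integral_add hint hcent, hcent0, add_zero]

theorem tendsto_entropyDensity {F : ℕ → X → ℝ} {x : X}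
    (hFf : Tendsto (fun k => F k x) atTop (𝓝 (f x)))
    (hnorm : Tendsto (fun k => ∫ x, F k x ^ 2 ∂μ) atTop (𝓝 (∫ x, f x ^ 2 ∂μ)))
    (hf : ∫ x, f x ^ 2 ∂μ ≠ 0) :
    Tendsto (fun k => entropyDensity μ (F k) x) atTop (𝓝 (entropyDensity μ f x)) :=
  hnorm.mul ((continuous_klFun.tendsto _).comp ((hFf.pow 2).div hnorm hf))

theorem EntropyLE.of_tendsto_of_dominated [IsProbabilityMeasure μ] {F : ℕ → X → ℝ} {H : X → ℝ}
    {C : ℕ → ℝ} {c : ℝ} (hent : ∀ k, EntropyLE μ (F k) (C k)) (hC : Tendsto C atTop (𝓝 c))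
    (hF : ∀ k, AEStronglyMeasurable (F k) μ) (hH : MemLp H 2 μ) (hFH : ∀ k x, |F k x| ≤ H x)
    (hFf : ∀ x, Tendsto (fun k => F k x) atTop (𝓝 (f x))) : EntropyLE μ f c := by
  have hF2 (k : ℕ) : MemLp (F k) 2 μ := hH.mono' (hF k) (.of_forall (hFH k))
  have hf2 : MemLp f 2 μ :=
    hH.mono' (aestronglyMeasurable_of_tendsto_ae atTop hF (.of_forall hFf)) <| .of_forall fun x =>
      le_of_tendsto' (hFf x).abs fun k => hFH k x
  have hdens (k : ℕ) := (entropyLE_iff (hF2 k)).1 (hent k)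
  by_cases hs : ∫ x, f x ^ 2 ∂μ = 0
  · exact entropyLE_of_integral_sq_eq_zero hs <| ge_of_tendsto' hC fun k =>
      (integral_nonneg (entropyDensity_nonneg (F k))).trans (hdens k).2
  · have hnorm := tendsto_integral_sq_of_dominated hF hH hFH hFf
    exact (entropyLE_iff hf2).2 <| integrable_and_integral_le_of_tendsto (fun k => (hdens k).1)
      (fun k => entropyDensity_nonneg (F k))
      (.of_forall fun x => tendsto_entropyDensity (hFf x) hnorm hs) (fun k => (hdens k).2) hC

theorem two_mul_sub_mul_exp_one_le_mul_log {s t : ℝ} (hs : 0 < s) (ht : 0 ≤ t) :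
    2 * t - s * Real.exp 1 ≤ t * Real.log (t / s) := by
  rcases ht.eq_or_lt with rfl | ht
  · simpa using (mul_pos hs (Real.exp_pos 1)).le
  have hse : 0 < s * Real.exp 1 := by positivity
  have h := mul_le_mul_of_nonneg_left (Real.self_sub_one_le_mul_log (div_pos ht hse).le) hse.le
  rw [← div_div, Real.log_div (div_pos ht hs).ne' (Real.exp_ne_zero 1), Real.log_exp] at h
  field_simp at h
  linarith

theorem EntropyLE.integral_sq_le [IsProbabilityMeasure μ] (hent : EntropyLE μ f C)
    (hf : MemLp f 2 μ) (hsupp : μ.real (Function.support f) ≤ Real.exp (-1)) :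
    ∫ x, f x ^ 2 ∂μ ≤ C := by
  let s := ∫ x, f x ^ 2 ∂μ
  rcases (integral_nonneg fun x => sq_nonneg (f x) : 0 ≤ s).eq_or_lt with hs | hs
  · simpa [EntropyLE, s, ← hs] using hent.2
  let S := (Function.support f).indicator fun _ => s * Real.exp 1
  have hmeas : NullMeasurableSet (Function.support f) μ := hf.1.nullMeasurableSet_support
  have hS : Integrable S μ := (integrable_const _).indicator₀ hmeas
  have hSs : ∫ x, S x ∂μ ≤ s :=
    calc ∫ x, S x ∂μ = μ.real (Function.support f) * (s * Real.exp 1) := by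
          rw [integral_indicator₀ hmeas, setIntegral_const, smul_eq_mul]
      _ ≤ Real.exp (-1) * (s * Real.exp 1) := by gcongr
      _ = s := by rw [mul_left_comm, ← Real.exp_add]; simp
  have hpt (x : X) : 2 * f x ^ 2 - S x ≤ f x ^ 2 * Real.log (f x ^ 2 / s) := by
    by_cases hx : f x = 0
    · simp [S, hx]
    · simpa [S, hx] using two_mul_sub_mul_exp_one_le_mul_log hs (sq_nonneg (f x))
  have hmono := (integral_mono ((hf.integrable_sq.const_mul 2).sub hS) hent.1 hpt).trans hent.2
  rw [integral_sub' (hf.integrable_sq.const_mul 2) hS, integral_const_mul] at hmono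
  linarith

end Entropy

section Clamp

/-- The truncation of `t` to the interval `[-k, k]`. -/
noncomputable def clamp (k t : ℝ) : ℝ :=
  max (min t k) (-k)

theorem lipschitzWith_clamp (k : ℝ) : LipschitzWith 1 (clamp k) :=
  (LipschitzWith.id.min_const k).max_const (-k)

theorem clamp_eq_self {k t : ℝ} (h : |t| ≤ k) : clamp k t = t := by
  rw [clamp, min_eq_left (abs_le.1 h).2, max_eq_left (abs_le.1 h).1]

theorem abs_clamp_le {k : ℝ} (hk : 0 ≤ k) (t : ℝ) : |clamp k t| ≤ k :=
  abs_le.2 ⟨le_max_right _ _, max_le (min_le_right _ _) (neg_le_self hk)⟩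

theorem clamp_zero {k : ℝ} (hk : 0 ≤ k) : clamp k 0 = 0 :=
  clamp_eq_self (by rwa [abs_zero])

theorem abs_clamp_le_abs {k : ℝ} (hk : 0 ≤ k) (t : ℝ) : |clamp k t| ≤ |t| := by
  simpa [Real.dist_eq, clamp_zero hk] using (lipschitzWith_clamp k).dist_le_mul t 0

theorem tendsto_clamp (t : ℝ) : Tendsto (fun k : ℕ => clamp k t) atTop (𝓝 t) := by
  refine tendsto_const_nhds.congr' ?_
  filter_upwards [tendsto_natCast_atTop_atTop.eventually_ge_atTop |t|] with k hk
  exact (clamp_eq_self hk).symm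

end Clamp

section LogSobolev

variable {X : Type*} [MetricSpace X] [MeasurableSpace X] [BorelSpace X] {μ : Measure X} {α : ℝ}

theorem memLp_toReal_gradNorm {f : X → ℝ} {g : X → ℝ} (hf : Continuous f) (hg : MemLp g 2 μ)
    (hfg : ∀ x, (gradNorm f x).toReal ≤ g x) : MemLp (fun x => (gradNorm f x).toReal) 2 μ :=
  hg.mono' (measurable_gradNorm hf).ennreal_toReal.aestronglyMeasurable <| .of_forall fun x => by
    rw [Real.norm_of_nonneg ENNReal.toReal_nonneg]
    exact hfg x

theorem LSI.entropyLE_of_gradNorm_le (hμ : LSI μ α) (hα : 0 < α) {f : X → ℝ} {g : X → ℝ≥0}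
    (hf : MemLp f 2 μ) (hg : MemLp (fun x => (g x : ℝ)) 2 μ) (hfg : ∀ x, gradNorm f x ≤ g x) :
    EntropyLE μ f (2 / α * ∫ x, (g x : ℝ) ^ 2 ∂μ) := by
  have hgrad (x : X) : gradNorm f x ≠ ∞ := ne_top_of_le_ne_top ENNReal.coe_ne_top (hfg x)
  have hle (x : X) : (gradNorm f x).toReal ≤ g x := ENNReal.toReal_mono ENNReal.coe_ne_top (hfg x)
  have hgrad2 : MemLp (fun x => (gradNorm f x).toReal) 2 μ :=
    memLp_toReal_gradNorm (continuous_of_gradNorm_ne_top hgrad) hg hle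
  have hent : EntropyLE μ f (2 / α * ∫ x, (gradNorm f x).toReal ^ 2 ∂μ) := hμ f hf hgrad hgrad2
  refine hent.mono (mul_le_mul_of_nonneg_left ?_ (by positivity))
  exact integral_mono hgrad2.integrable_sq hg.integrable_sq fun x =>
    pow_le_pow_left₀ ENNReal.toReal_nonneg (hle x) 2

theorem LSI.of_bounded [IsProbabilityMeasure μ] (hα : 0 < α)
    (h : ∀ (f : X → ℝ) (M : ℝ), (∀ x, |f x| ≤ M) → (∀ x, gradNorm f x ≠ ∞) →
      MemLp (fun x => (gradNorm f x).toReal) 2 μ →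
      EntropyLE μ f (2 / α * ∫ x, (gradNorm f x).toReal ^ 2 ∂μ)) : LSI μ α := by
  intro f hf hgrad hgrad2
  have hfc : Continuous f := continuous_of_gradNorm_ne_top hgrad
  have hFc (k : ℕ) : Continuous (clamp k ∘ f) := (lipschitzWith_clamp k).continuous.comp hfc
  have hle (k : ℕ) (x : X) : gradNorm (clamp k ∘ f) x ≤ gradNorm f x := by
    simpa using gradNorm_comp_left_le (lipschitzWith_clamp k) f x
  have hle_toReal (k : ℕ) (x : X) :
      (gradNorm (clamp k ∘ f) x).toReal ≤ (gradNorm f x).toReal :=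
    ENNReal.toReal_mono (hgrad x) (hle k x)
  have hF2 (k : ℕ) : MemLp (fun x => (gradNorm (clamp k ∘ f) x).toReal) 2 μ :=
    memLp_toReal_gradNorm (hFc k) hgrad2 (hle_toReal k)
  have hent (k : ℕ) :
      EntropyLE μ (clamp k ∘ f) (2 / α * ∫ x, (gradNorm f x).toReal ^ 2 ∂μ) := by
    refine (h _ k (fun x => abs_clamp_le k.cast_nonneg (f x))
      (fun x => ne_top_of_le_ne_top (hgrad x) (hle k x)) (hF2 k)).mono ?_
    refine mul_le_mul_of_nonneg_left ?_ (by positivity)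
    exact integral_mono (hF2 k).integrable_sq hgrad2.integrable_sq fun x =>
      pow_le_pow_left₀ ENNReal.toReal_nonneg (hle_toReal k x) 2
  exact EntropyLE.of_tendsto_of_dominated hent tendsto_const_nhds
    (fun k => (hFc k).aestronglyMeasurable) hf.abs
    (fun k x => abs_clamp_le_abs k.cast_nonneg (f x)) (fun x => tendsto_clamp (f x))

theorem exists_measureReal_lt_abs_le {Ω : Type*} [MeasurableSpace Ω] {P : Measure Ω}
    [IsFiniteMeasure P] {f : Ω → ℝ} (hf : AEMeasurable f P) {ε : ℝ} (hε : 0 < ε) :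
    ∃ r : ℝ, P.real {x | r < |f x|} ≤ ε := by
  have htight : Tendsto (fun r : ℝ => P.map f {t | r < |t|}) atTop (𝓝 0) := by
    simpa using tendsto_measure_norm_gt_of_isTightMeasureSet
      (isTightMeasureSet_singleton (μ := P.map f))
  obtain ⟨r, hr⟩ := (htight.eventually_lt_const (ENNReal.ofReal_pos.2 hε)).exists
  rw [Measure.map_apply_of_aemeasurable hf (measurableSet_lt measurable_const (by fun_prop))] at hr
  exact ⟨r, ENNReal.toReal_le_of_le_ofReal hε.le hr.le⟩

theorem LSI.integral_sq_le_of_lipschitzWith [IsProbabilityMeasure μ] (hμ : LSI μ α) (hα : 0 < α)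
    {K : ℝ≥0} {f : X → ℝ} (hf : LipschitzWith K f) (hf2 : MemLp f 2 μ)
    (hsupp : μ.real (Function.support f) ≤ Real.exp (-1)) :
    ∫ x, f x ^ 2 ∂μ ≤ 2 / α * K ^ 2 := by
  have hent := hμ.entropyLE_of_gradNorm_le hα hf2 (memLp_const _) (gradNorm_le_of_lipschitzWith hf)
  simpa using hent.integral_sq_le hf2 hsupp

theorem LSI.memLp_of_lipschitzWith [IsProbabilityMeasure μ] (hμ : LSI μ α) (hα : 0 < α)
    {K : ℝ≥0} {f : X → ℝ} (hf : LipschitzWith K f) : MemLp f 2 μ := by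
  obtain ⟨r, hr⟩ := exists_measureReal_lt_abs_le (hf.continuous.measurable.aemeasurable (μ := μ))
    (Real.exp_pos (-1))
  let excess (x : X) : ℝ := max (|f x| - r) 0
  have hexcess : LipschitzWith K excess := by
    simpa using ((lipschitzWith_one_norm.comp hf).sub (.const r)).max_const 0
  have hclamp (k : ℕ) : LipschitzWith K (clamp k ∘ excess) := by
    simpa using (lipschitzWith_clamp k).comp hexcess
  have hclamp2 (k : ℕ) : MemLp (clamp k ∘ excess) 2 μ :=
    .of_bound (hclamp k).continuous.aestronglyMeasurable k <|
      .of_forall fun x => abs_clamp_le k.cast_nonneg (excess x)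
  have hsupp (k : ℕ) : μ.real (Function.support (clamp k ∘ excess)) ≤ Real.exp (-1) := by
    refine (measureReal_mono fun x hx => ?_).trans hr
    by_contra hxr
    refine hx ?_
    have : excess x = 0 := max_eq_right (sub_nonpos.2 (not_lt.1 hxr))
    simp [this, clamp_zero]
  have hexcess2 : MemLp excess 2 μ :=
    (memLp_two_iff_integrable_sq hexcess.continuous.aestronglyMeasurable).2
      (integrable_and_integral_le_of_tendsto (fun k => (hclamp2 k).integrable_sq)
        (fun k x => sq_nonneg _) (.of_forall fun x => (tendsto_clamp (excess x)).pow 2)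
        (fun k => hμ.integral_sq_le_of_lipschitzWith hα (hclamp k) (hclamp2 k) (hsupp k))
        tendsto_const_nhds).1
  refine (hexcess2.add (memLp_const r)).mono' hf.continuous.aestronglyMeasurable <|
    .of_forall fun x => ?_
  exact sub_le_iff_le_add.1 (le_max_left _ _)

end LogSobolev

section Limit

variable {E : Type*} [MeasurableSpace E] {ν : Measure E} [IsProbabilityMeasure ν]
  {X : ℕ → Type*} [∀ n, MetricSpace (X n)] [∀ n, MeasurableSpace (X n)] [∀ n, BorelSpace (X n)]
  {ι : ∀ n, X n → E} {p : ∀ n, E → X n} {α : ℝ}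

theorem LSI.entropyLE_comp_of_gradNorm_le [MetricSpace E] [BorelSpace E] {Y : Type*} [MetricSpace Y]
    [MeasurableSpace Y] [BorelSpace Y] {φ : Y → E} {q : E → Y} (hLSI : LSI (ν.map q) α)
    (hα : 0 < α) (hφ : LipschitzWith 1 φ) (hq : Measurable q) {u : E → ℝ} {g : E → ℝ≥0} {M : ℝ}
    {B : ℝ≥0} (hu : ∀ x, |u x| ≤ M) (hg : Continuous g) (hgB : ∀ x, g x ≤ B)
    (hug : ∀ x, gradNorm u x ≤ g x) :
    EntropyLE ν (fun x => u (φ (q x))) (2 / α * ∫ x, (g (φ (q x)) : ℝ) ^ 2 ∂ν) := by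
  have := Measure.isProbabilityMeasure_map (μ := ν) hq.aemeasurable
  have huc : Continuous u :=
    continuous_of_gradNorm_ne_top fun x => ne_top_of_le_ne_top ENNReal.coe_ne_top (hug x)
  have huφ : AEStronglyMeasurable (u ∘ φ) (ν.map q) :=
    (huc.comp hφ.continuous).aestronglyMeasurable
  have hgφ : Continuous fun y => (g (φ y) : ℝ) := by have := hφ.continuous; fun_prop
  have hgrad (y : Y) : gradNorm (u ∘ φ) y ≤ (g ∘ φ) y := by
    simpa using (gradNorm_comp_le hφ u y).trans (mul_le_mul_right (hug (φ y)) _)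
  have hent := hLSI.entropyLE_of_gradNorm_le hα (.of_bound huφ M (.of_forall fun y => hu (φ y)))
    (.of_bound hgφ.aestronglyMeasurable B (.of_forall fun y => by simpa using hgB (φ y))) hgrad
  have hint : ∫ y, (g (φ y) : ℝ) ^ 2 ∂(ν.map q) = ∫ x, (g (φ (q x)) : ℝ) ^ 2 ∂ν :=
    integral_map hq.aemeasurable (hgφ.pow 2).aestronglyMeasurable
  rw [← hint]
  exact EntropyLE.comp_of_map (f := u ∘ φ) hq.aemeasurable huφ hent

theorem entropyLE_of_gradNorm_le_of_forall_lsi_map [MetricSpace E] [BorelSpace E] (hα : 0 < α)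
    (hι : ∀ n, LipschitzWith 1 (ι n)) (hp : ∀ n, Measurable (p n))
    (hιp : ∀ x, Tendsto (fun n => ι n (p n x)) atTop (𝓝 x)) (hLSI : ∀ n, LSI (ν.map (p n)) α)
    {u : E → ℝ} {g : E → ℝ≥0} {M : ℝ} {B : ℝ≥0} (hu : ∀ x, |u x| ≤ M) (hg : Continuous g)
    (hgB : ∀ x, g x ≤ B) (hug : ∀ x, gradNorm u x ≤ g x) :
    EntropyLE ν u (2 / α * ∫ x, (g x : ℝ) ^ 2 ∂ν) := by
  have huc : Continuous u :=
    continuous_of_gradNorm_ne_top fun x => ne_top_of_le_ne_top ENNReal.coe_ne_top (hug x)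
  have hgc : Continuous fun x => (g x : ℝ) := by fun_prop
  have hmeas (n : ℕ) : Measurable fun x => ι n (p n x) :=
    (hι n).continuous.measurable.comp (hp n)
  have hg_tendsto : Tendsto (fun n => ∫ x, (g (ι n (p n x)) : ℝ) ^ 2 ∂ν) atTop
      (𝓝 (∫ x, (g x : ℝ) ^ 2 ∂ν)) :=
    tendsto_integral_sq_of_dominated
      (fun n => (hgc.measurable.comp (hmeas n)).aestronglyMeasurable) (memLp_const (B : ℝ))
      (fun n x => by simpa using hgB _) fun x => (hgc.tendsto x).comp (hιp x)
  exact EntropyLE.of_tendsto_of_dominated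
    (fun n => (hLSI n).entropyLE_comp_of_gradNorm_le hα (hι n) (hp n) hu hg hgB hug)
    (hg_tendsto.const_mul _)
    (fun n => (huc.measurable.comp (hmeas n)).aestronglyMeasurable) (memLp_const M)
    (fun n x => hu _) fun x => (huc.tendsto x).comp (hιp x)

theorem ofReal_integral_toReal_sq {Ω : Type*} [MeasurableSpace Ω] {P : Measure Ω} {G : Ω → ℝ≥0∞}
    (hG : ∀ x, G x ≠ ∞) (hG2 : MemLp (fun x => (G x).toReal) 2 P) :
    ENNReal.ofReal (∫ x, (G x).toReal ^ 2 ∂P) = ∫⁻ x, G x ^ 2 ∂P := by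
  rw [ofReal_integral_eq_lintegral_ofReal hG2.integrable_sq (.of_forall fun x => sq_nonneg _)]
  refine lintegral_congr fun x => ?_
  rw [ENNReal.ofReal_pow ENNReal.toReal_nonneg, ENNReal.ofReal_toReal (hG x)]

variable [NormedAddCommGroup E] [NormedSpace ℝ E] [CompleteSpace E] [SecondCountableTopology E]
  [BorelSpace E]

theorem entropyLE_of_bounded_of_forall_lsi_map (hα : 0 < α) (hι : ∀ n, LipschitzWith 1 (ι n))
    (hp : ∀ n, Measurable (p n)) (hιp : ∀ x, Tendsto (fun n => ι n (p n x)) atTop (𝓝 x))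
    (hLSI : ∀ n, LSI (ν.map (p n)) α) {f : E → ℝ} {M : ℝ} (hf : ∀ x, |f x| ≤ M)
    (hgrad : ∀ x, gradNorm f x ≠ ∞) (hgrad2 : MemLp (fun x => (gradNorm f x).toReal) 2 ν) :
    EntropyLE ν f (2 / α * ∫ x, (gradNorm f x).toReal ^ 2 ∂ν) := by
  refine entropyLE_of_forall_lt fun C hC => ?_
  have hI := ofReal_integral_toReal_sq hgrad hgrad2
  set I := ∫ x, (gradNorm f x).toReal ^ 2 ∂ν
  have hI0 : 0 ≤ I := integral_nonneg fun x => sq_nonneg _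
  obtain ⟨ε, hε, hεC⟩ : ∃ ε > 0, 2 / α * (I + ε) = C :=
    ⟨α / 2 * (C - 2 / α * I), mul_pos (by positivity) (sub_pos.2 hC), by field_simp; ring⟩
  obtain ⟨u, g, hu, hg, hgk, hug, hgI, huf⟩ := exists_tendsto_gradNorm_le_lintegral_sq_le ν hf hgrad
    (hI ▸ ENNReal.ofReal_ne_top) (ENNReal.ofReal_pos.2 hε).ne'
  have huc (k : ℕ) : Continuous (u k) :=
    continuous_of_gradNorm_ne_top fun x => ne_top_of_le_ne_top ENNReal.coe_ne_top (hug k x)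
  have hgc (k : ℕ) : Continuous fun x => (g k x : ℝ) := by have := hg k; fun_prop
  have hg2 (k : ℕ) : MemLp (fun x => (g k x : ℝ)) 2 ν :=
    .of_bound (hgc k).aestronglyMeasurable k (.of_forall fun x => by
      simpa using NNReal.coe_le_coe.2 (hgk k x))
  have hgIε (k : ℕ) : ∫ x, (g k x : ℝ) ^ 2 ∂ν ≤ I + ε := by
    rw [← ENNReal.ofReal_le_ofReal_iff (by positivity), ENNReal.ofReal_add hI0 hε.le, hI]
    exact (ofReal_integral_toReal_sq (fun x => ENNReal.coe_ne_top) (hg2 k)).trans_le (hgI k)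
  refine EntropyLE.of_tendsto_of_dominated (fun k => ?_) tendsto_const_nhds
    (fun k => (huc k).aestronglyMeasurable) (memLp_const M) hu huf
  refine (entropyLE_of_gradNorm_le_of_forall_lsi_map hα hι hp hιp hLSI (hu k) (hg k) (hgk k)
    (hug k)).mono ?_
  rw [← hεC]
  exact mul_le_mul_of_nonneg_left (hgIε k) (by positivity)

theorem LSI.of_frequently_map (hα : 0 < α) (hι : ∀ n, LipschitzWith 1 (ι n))
    (hp : ∀ n, Measurable (p n)) (hιp : ∀ x, Tendsto (fun n => ι n (p n x)) atTop (𝓝 x))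
    (hLSI : ∃ᶠ n in atTop, LSI (ν.map (p n)) α) : LSI ν α := by
  obtain ⟨φ, hφ, hLSIφ⟩ := extraction_of_frequently_atTop hLSI
  exact LSI.of_bounded hα fun f M hf hgrad hgrad2 =>
    entropyLE_of_bounded_of_forall_lsi_map hα (fun n => hι (φ n)) (fun n => hp (φ n))
      (fun x => (hιp x).comp hφ.tendsto_atTop) hLSIφ hf hgrad hgrad2

end Limit

section Transport

theorem isMetricCoupling_of_isometry {X Y : Type*} [MetricSpace X] [MetricSpace Y] {ι : X → Y}
    (hι : Isometry ι) :
    IsMetricCoupling fun z w : X ⊕ Y => edist (Sum.elim ι id z) (Sum.elim ι id w) where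
  self _ := edist_self _
  symm _ _ := edist_comm _ _
  triangle _ _ _ := edist_triangle _ _ _
  left := hι
  right _ _ := rfl

theorem isTransportPlan_map_prodMk {X Y : Type*} [MeasurableSpace X] [MeasurableSpace Y]
    (ν : Measure Y) {p : Y → X} (hp : Measurable p) :
    IsTransportPlan (ν.map p) ν (ν.map fun y => (p y, y)) := by
  have hpair : Measurable fun y => (p y, y) := hp.prodMk measurable_id
  exact ⟨Measure.map_map measurable_fst hpair,
    (Measure.map_map measurable_snd hpair).trans Measure.map_id⟩

theorem DL2_map_le {X Y : Type*} [MetricSpace X] [MeasurableSpace X] [BorelSpace X]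
    [MetricSpace Y] [MeasurableSpace Y] [BorelSpace Y] [SecondCountableTopology Y]
    (ν : Measure Y) {ι : X → Y} {p : Y → X} (hι : Isometry ι) (hp : Measurable p) :
    DL2 (ν.map p) ν ≤ (∫⁻ y, edist (ι (p y)) y ^ 2 ∂ν) ^ (1 / 2 : ℝ) := by
  refine (iInf₂_le _ (isMetricCoupling_of_isometry hι)).trans
    ((iInf₂_le _ (isTransportPlan_map_prodMk ν hp)).trans_eq ?_)
  have hcost : Measurable fun z : X × Y => edist (ι z.1) z.2 ^ 2 :=
    ((hι.continuous.measurable.comp measurable_fst).edist measurable_snd).pow_const 2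
  exact congrArg (· ^ (1 / 2 : ℝ)) (lintegral_map hcost (hp.prodMk measurable_id))

variable {E : Type*} [NormedAddCommGroup E] [NormedSpace ℝ E] [CompleteSpace E]

theorem exists_norm_apply_sub_le_of_tendsto {T : ℕ → E →L[ℝ] E}
    (hT : ∀ x, Tendsto (fun n => T n x) atTop (𝓝 x)) : ∃ C, ∀ n x, ‖T n x - x‖ ≤ C * ‖x‖ := by
  have hbdd (x : E) : ∃ B, ∀ n, ‖(T n - .id ℝ E) x‖ ≤ B := by
    obtain ⟨B, hB⟩ := ((hT x).sub_const x).norm.bddAbove_range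
    exact ⟨B, fun n => hB ⟨n, rfl⟩⟩
  obtain ⟨C, hC⟩ := banach_steinhaus hbdd
  exact ⟨C, fun n x => ContinuousLinearMap.le_of_opNorm_le _ (hC n) x⟩

theorem tendsto_lintegral_edist_sq_of_tendsto [SecondCountableTopology E] [MeasurableSpace E]
    [BorelSpace E] {ν : Measure E} (hν : MemLp (fun x : E => ‖x‖) 2 ν) {T : ℕ → E →L[ℝ] E}
    (hT : ∀ x, Tendsto (fun n => T n x) atTop (𝓝 x)) :
    Tendsto (fun n => ∫⁻ x, edist (T n x) x ^ 2 ∂ν) atTop (𝓝 0) := by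
  obtain ⟨C, hC⟩ := exists_norm_apply_sub_le_of_tendsto hT
  rw [← lintegral_zero (μ := ν)]
  refine tendsto_lintegral_of_dominated_convergence (fun x => ENNReal.ofReal ((C * ‖x‖) ^ 2))
    (fun n => ((T n).continuous.measurable.edist measurable_id).pow_const 2)
    (fun n => .of_forall fun x => ?_) (hν.const_mul C).integrable_sq.lintegral_lt_top.ne
    (.of_forall fun x => ?_)
  · dsimp only
    rw [edist_dist, dist_eq_norm, ← ENNReal.ofReal_pow (norm_nonneg _)]
    exact ENNReal.ofReal_le_ofReal (pow_le_pow_left₀ (norm_nonneg _) (hC n x) 2)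
  · simpa using ENNReal.Tendsto.pow (n := 2) (tendsto_iff_edist_tendsto_0.1 (hT x))

end Transport

theorem lemma2p1_general {E : Type*} [NormedAddCommGroup E] [NormedSpace ℝ E] [CompleteSpace E]
    [SecondCountableTopology E] [MeasurableSpace E] [BorelSpace E]
    {X : ℕ → Type*} [∀ n, NormedAddCommGroup (X n)] [∀ n, NormedSpace ℝ (X n)]
    [∀ n, MeasurableSpace (X n)] [∀ n, BorelSpace (X n)]
    (ι : ∀ n, X n →ₗᵢ[ℝ] E) (p : ∀ n, E →L[ℝ] X n)
    (hιp : ∀ x, Tendsto (fun n => ι n (p n x)) atTop (𝓝 x))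
    (ν : Measure E) [IsProbabilityMeasure ν] {α : ℝ} (hα : 0 < α)
    (hLSI : ∃ᶠ n in atTop, LSI (ν.map (p n)) α) :
    LSI ν α ∧ Tendsto (fun n => DL2 (ν.map (p n)) ν) atTop (𝓝 0) := by
  have hp (n : ℕ) : Measurable (p n) := (p n).continuous.measurable
  have hν : LSI ν α := .of_frequently_map hα (fun n => (ι n).lipschitz) hp hιp hLSI
  have hcost : Tendsto (fun n => ∫⁻ x, edist (ι n (p n x)) x ^ 2 ∂ν) atTop (𝓝 0) :=
    tendsto_lintegral_edist_sq_of_tendsto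
      (T := fun n => (ι n).toContinuousLinearMap ∘L p n)
      (hν.memLp_of_lipschitzWith hα lipschitzWith_one_norm) hιp
  have hsqrt : Tendsto (fun n => (∫⁻ x, edist (ι n (p n x)) x ^ 2 ∂ν) ^ (1 / 2 : ℝ)) atTop
      (𝓝 0) := by
    simpa using hcost.ennrpow_const (1 / 2)
  exact ⟨hν, tendsto_of_tendsto_of_tendsto_of_le_of_le tendsto_const_nhds hsqrt
    (fun _ => zero_le) fun n => DL2_map_le ν (ι n).isometry (hp n)⟩

section EllTwo

/-- `firstCoords n` as a continuous linear map. -/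
noncomputable def firstCoordsL (n : ℕ) : ellTwo →L[ℝ] EuclideanSpace ℝ (Fin n) :=
  (PiLp.continuousLinearEquiv 2 ℝ fun _ : Fin n => ℝ).symm.toContinuousLinearMap ∘L
    ContinuousLinearMap.pi fun i => lp.evalCLM (𝕜 := ℝ) (fun _ : ℕ => ℝ) 2 (i : ℕ)

/-- The embedding of Euclidean space into `ℓ²` as the sequences supported in the first `n`
coordinates. -/
noncomputable def embedCoords (n : ℕ) : EuclideanSpace ℝ (Fin n) →ₗᵢ[ℝ] ellTwo where
  toFun ξ := ∑ i : Fin n, lp.single 2 (i : ℕ) (ξ i)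
  map_add' ξ η := by simp [lp.single_add, Finset.sum_add_distrib]
  map_smul' c ξ := by simp [← lp.single_smul, Finset.smul_sum]
  norm_map' ξ := by
    have h := lp.norm_sum_single (E := fun _ : ℕ => ℝ) (p := 2) (by norm_num)
      (fun j => if h : j < n then ξ ⟨j, h⟩ else 0) (Finset.range n)
    rw [← sq_eq_sq₀ (norm_nonneg _) (norm_nonneg _), EuclideanSpace.norm_sq_eq]
    simpa [Finset.sum_range] using h

theorem tendsto_embedCoords_firstCoordsL (x : ellTwo) :
    Tendsto (fun n => embedCoords n (firstCoordsL n x)) atTop (𝓝 x) := by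
  refine (lp.hasSum_single (by norm_num) x).tendsto_sum_nat.congr fun n => ?_
  exact Finset.sum_range fun j => lp.single 2 j (x j)

instance : SecondCountableTopology ellTwo := by
  have hdense : DenseRange fun z : Σ n, EuclideanSpace ℝ (Fin n) => embedCoords z.1 z.2 := fun x =>
    mem_closure_of_tendsto (tendsto_embedCoords_firstCoordsL x) <|
      .of_forall fun n => ⟨⟨n, firstCoordsL n x⟩, rfl⟩
  have := hdense.separableSpace (continuous_sigma fun n => (embedCoords n).continuous)
  exact UniformSpace.secondCountable_of_separable ellTwo

end EllTwo

theorem lemma2p1 [MeasurableSpace ellTwo] [BorelSpace ellTwo]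
    (ν : Measure ellTwo) [IsProbabilityMeasure ν]
    (α : ℝ) (hα : 0 < α)
    (hLSI : ∀ n : ℕ, 1 ≤ n → LSI (marginal ν n) α) :
    LSI ν α ∧ Tendsto (fun n : ℕ => DL2 (marginal ν n) ν) atTop (𝓝 0) :=
  lemma2p1_general embedCoords firstCoordsL tendsto_embedCoords_firstCoordsL ν hα
    (eventually_atTop.2 ⟨1, hLSI⟩).frequently
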